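/- For $T\in\mathbb N$ write $[T]=\{1,\dots,T\}$. A \emph{temporal cost graph} $(G,F)$ consists of a static graph $G$ with vertex set $V$ and a cost function $F:V\times V\times[T]\times[T]\to\mathbb N_0\cup\{\infty\}$, where $F(u,v,t_1,t_2)$ is the cost of going from $u$ to $v$ departing at time $t_1$ and arriving at time $t_2$, such that $F(u,v,t_1,t_2)=\infty$ whenever $t_1\ge t_2$, $F(v,v,t_1,t_2)=0$ whenever $t_1<t_2$, and $F(u,v,t_1,t_2)>0$ whenever $u\ne v$. Its lifetime is $T\ge 1$. A \emph{valid walk} is a finite, possibly empty, sequence of quadruples $(u_i,v_i,t_i,t_i')$, $1\le i\le\ell$, with $t_i<t_i'$ and $F(u_i,v_i,t_i,t_i')<\infty$ for all $i$, and $v_i=u_{i+1}$ and $t_i'\le t_{i+1}$ for all $i<\ell$; it goes from $u_1$ to $v_\ell$ (the empty walk stays at its start vertex), and its cost is $\sum_i F(u_i,v_i,t_i,t_i')$. The problem \textsc{Changing Cost Temporal Orienteering} (CCTO) is: given a temporal cost graph $(G,F)$, vertices $v_s,v_t$, a target $k\in\mathbb N$ and a budget $f\in\mathbb N$, is there a valid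 walk from $v_s$ to $v_t$ that visits at least $k$ distinct vertices (counting $v_s$ and $v_t$) and has cost at most $f$? Running times are numbers of steps of a random access machine on which addition, truncated subtraction, memory access, tests, and looking up a value $F(u,v,t_1,t_2)$ of the input each take one step. \textbf{Theorem.} CCTO can be solved in time $k^{O(k)}\,T^4 n^4\log(n+1)$ on temporal cost graphs with $n$ vertices and lifetime $T$: there are one program and one constant $C$ such that, on every input, the program halts with the correct answer after at most $C\,k^{Ck}\,T^4n^4\log(n+1)$ steps (with $0^0=1$). In particular, CCTO is fixed-parameter tractable with parameter $k$: some program solves every input in at most $g(k)\cdot N^{c}$ steps, where $g$ is a computable function, $c$ is a constant, and $N=n^2T^2+6$ is the number of words of the input (the table of $F$ and the numbers $n,T,k,f,v_s,v_t$). -/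

import Mathlib

/-! ### Temporal cost graphs and the problem CCTO -/

/-- A temporal cost graph on the vertex set `V` with time steps `1, …, T`: a static graph together
with a cost for every ordered pair of vertices, departure time and arrival time; `⊤` is infinite
cost. The time step `i + 1` is represented by `i : Fin T`. -/
structure TemporalCostGraph (V : Type*) (T : ℕ) where
  /-- the static graph -/
  graph : SimpleGraph V
  /-- `cost u v t₁ t₂`: the cost of going from `u` to `v`, departing at `t₁` and arriving at `t₂` -/
  cost : V → V → Fin T → Fin T → ℕ∞
  cost_eq_top : ∀ u v t₁ t₂, t₂ ≤ t₁ → cost u v t₁ t₂ = ⊤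
  cost_self : ∀ v t₁ t₂, t₁ < t₂ → cost v v t₁ t₂ = 0
  cost_pos : ∀ u v t₁ t₂, u ≠ v → 0 < cost u v t₁ t₂

/-- A quadruple (start vertex, end vertex, departure time, arrival time). -/
structure TimedMove (V : Type*) (T : ℕ) where
  src : V
  dst : V
  dep : Fin T
  arr : Fin T

namespace TemporalCostGraph

variable {V : Type*} {T : ℕ}

/-- The lifetime: the latest time step at which some finite-cost move arrives. -/
noncomputable def lifetime (G : TemporalCostGraph V T) : ℕ :=
  sSup {m : ℕ | ∃ (u v : V) (t t' : Fin T), G.cost u v t t' < ⊤ ∧ m = (t' : ℕ) + 1}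

/-- As staying at a vertex is free, the lifetime is the number `T` of time steps (for `T = 1` no
move has finite cost at all). -/
theorem lifetime_eq [Nonempty V] (G : TemporalCostGraph V T) (hT : 2 ≤ T) : G.lifetime = T := by
  obtain ⟨v⟩ := ‹Nonempty V›
  have hub : ∀ m ∈ {m : ℕ | ∃ (u v : V) (t t' : Fin T), G.cost u v t t' < ⊤ ∧ m = (t' : ℕ) + 1},
      m ≤ T := by
    rintro m ⟨u, w, t, t', -, rfl⟩
    exact t'.isLt
  have hmem : T ∈ {m : ℕ | ∃ (u v : V) (t t' : Fin T),
      G.cost u v t t' < ⊤ ∧ m = (t' : ℕ) + 1} := by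
    refine ⟨v, v, ⟨0, by omega⟩, ⟨T - 1, by omega⟩, ?_, ?_⟩
    · rw [G.cost_self v _ _ (by simp only [Fin.mk_lt_mk]; omega)]
      exact ENat.top_pos
    · simp only
      omega
  exact le_antisymm (csSup_le ⟨T, hmem⟩ hub) (le_csSup ⟨T, hub⟩ hmem)

/-- Valid walks: consecutive moves share a vertex, no move departs before the previous one has
arrived, and every move goes forward in time and has finite cost. -/
def IsValidWalk (G : TemporalCostGraph V T) (W : List (TimedMove V T)) : Prop :=
  W.IsChain (fun p q => p.dst = q.src ∧ p.arr ≤ q.dep) ∧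
    ∀ q ∈ W, q.dep < q.arr ∧ G.cost q.src q.dst q.dep q.arr < ⊤

/-- The cost of a walk. -/
noncomputable def walkCost (G : TemporalCostGraph V T) (W : List (TimedMove V T)) : ℕ∞ :=
  (W.map fun q => G.cost q.src q.dst q.dep q.arr).sum

end TemporalCostGraph

/-- The sequence of moves `W` goes from `s` to `t`; the empty sequence stays at `s`. -/
def WalkFromTo {V : Type*} {T : ℕ} (s t : V) (W : List (TimedMove V T)) : Prop :=
  (W = [] ∧ s = t) ∨
    ((∃ q, W.head? = some q ∧ q.src = s) ∧ ∃ q, W.getLast? = some q ∧ q.dst = t)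

/-- The vertices visited by a walk starting at `s`, including its first and last vertex. -/
def visited {V : Type*} {T : ℕ} (s : V) (W : List (TimedMove V T)) : Set V :=
  {v | v = s ∨ ∃ q ∈ W, v = q.src ∨ v = q.dst}

/-- Inputs of Changing Cost Temporal Orienteering (CCTO). -/
structure CCTOInstance where
  /-- number of vertices -/
  n : ℕ
  /-- lifetime -/
  T : ℕ
  T_pos : 0 < T
  /-- the temporal cost graph -/
  G : TemporalCostGraph (Fin n) T
  source : Fin n
  sink : Fin n
  /-- target number `k` of distinct vertices -/
  k : ℕ
  budget : ℕ

namespace CCTOInstance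

/-- The question of CCTO: is there a valid walk from the source to the sink that visits at least
`k` distinct vertices and has cost at most the budget? -/
def IsYes (I : CCTOInstance) : Prop :=
  ∃ W : List (TimedMove (Fin I.n) I.T),
    I.G.IsValidWalk W ∧ WalkFromTo I.source I.sink W ∧
      I.k ≤ (visited I.source W).ncard ∧ I.G.walkCost W ≤ (I.budget : ℕ∞)

/-- The number of machine words of an input: the entries of the table of costs and the six numbers
`n`, `T`, `k`, budget, source, sink. -/
def size (I : CCTOInstance) : ℕ := I.n ^ 2 * I.T ^ 2 + 6

end CCTOInstance

/-! ### Random access machines with a table that can be looked up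

The machine is the unit-cost random access machine whose arithmetic consists of addition and
truncated subtraction of natural numbers (there is no multiplication or division). It has
registers, arrays addressed by the content of a register, and an instruction that looks up one
value of the cost function of the input. Programs are structured, with conditionals and loops in
place of jumps. -/

namespace RAM

/-- Elementary instructions; numbers that stand for registers or arrays are part of the program. -/
inductive Instr
  /-- `r_i := c` -/
  | const (i c : ℕ)
  /-- `r_i := r_j + r_l` -/
  | add (i j l : ℕ)
  /-- `r_i := r_j - r_l`, and `0` if this is negative -/
  | sub (i j l : ℕ)
  /-- `r_i := a[r_j]` for the array with number `a` -/
  | load (i a j : ℕ)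
  /-- `a[r_i] := r_j` for the array with number `a` -/
  | store (a i j : ℕ)
  /-- `r_i := F(r_u, r_v, r_p, r_q)` for the input table `F` -/
  | lookup (i u v p q : ℕ)

/-- Programs. -/
inductive Program
  | skip
  | instr (c : Instr)
  | seq (P Q : Program)
  /-- run `P` if `r_i ≠ 0`, and otherwise `Q` -/
  | ifNonzero (i : ℕ) (P Q : Program)
  /-- repeat `P` as long as `r_i ≠ 0` -/
  | whileNonzero (i : ℕ) (P : Program)

/-- Contents of the registers and of the arrays. -/
structure State where
  reg : ℕ → ℕ
  arr : ℕ → ℕ → ℕ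

/-- Assign `x` to register `i`. -/
def State.setReg (σ : State) (i x : ℕ) : State :=
  { σ with reg := Function.update σ.reg i x }

/-- Assign `x` to entry `j` of array `a`. -/
def State.setArr (σ : State) (a j x : ℕ) : State :=
  { σ with arr := Function.update σ.arr a (Function.update (σ.arr a) j x) }

/-- The effect of one instruction, with input table `F`. -/
def Instr.exec (F : ℕ → ℕ → ℕ → ℕ → ℕ) : Instr → State → State
  | const i c, σ => σ.setReg i c
  | add i j l, σ => σ.setReg i (σ.reg j + σ.reg l)
  | sub i j l, σ => σ.setReg i (σ.reg j - σ.reg l)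
  | load i a j, σ => σ.setReg i (σ.arr a (σ.reg j))
  | store a i j, σ => σ.setArr a (σ.reg i) (σ.reg j)
  | lookup i u v p q, σ => σ.setReg i (F (σ.reg u) (σ.reg v) (σ.reg p) (σ.reg q))

/-- `Run F P σ t τ`: with input table `F`, the program `P` started in state `σ` halts in state `τ`
after exactly `t` steps. Each instruction and each test of a register is one step. -/
inductive Run (F : ℕ → ℕ → ℕ → ℕ → ℕ) : Program → State → ℕ → State → Prop
  | skip (σ : State) : Run F Program.skip σ 0 σ
  | instr (c : Instr) (σ : State) : Run F (Program.instr c) σ 1 (c.exec F σ)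
  | seq {P Q : Program} {σ τ υ : State} {t t' : ℕ} (hP : Run F P σ t τ) (hQ : Run F Q τ t' υ) :
      Run F (Program.seq P Q) σ (t + t') υ
  | ifTrue {i : ℕ} {P Q : Program} {σ τ : State} {t : ℕ} (h : σ.reg i ≠ 0) (hP : Run F P σ t τ) :
      Run F (Program.ifNonzero i P Q) σ (t + 1) τ
  | ifFalse {i : ℕ} {P Q : Program} {σ τ : State} {t : ℕ} (h : σ.reg i = 0) (hQ : Run F Q σ t τ) :
      Run F (Program.ifNonzero i P Q) σ (t + 1) τ
  | whileTrue {i : ℕ} {P : Program} {σ τ υ : State} {t t' : ℕ} (h : σ.reg i ≠ 0)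
      (hP : Run F P σ t τ) (hW : Run F (Program.whileNonzero i P) τ t' υ) :
      Run F (Program.whileNonzero i P) σ (t + t' + 1) υ
  | whileFalse {i : ℕ} {P : Program} {σ : State} (h : σ.reg i = 0) :
      Run F (Program.whileNonzero i P) σ 1 σ

/-- Programs are deterministic: final state and number of steps are determined by the start. -/
theorem Run.deterministic {F : ℕ → ℕ → ℕ → ℕ → ℕ} {P : Program} {σ τ τ' : State} {t t' : ℕ}
    (h : Run F P σ t τ) (h' : Run F P σ t' τ') : t = t' ∧ τ = τ' := by
  induction h generalizing t' τ' with
  | skip σ => cases h'; exact ⟨rfl, rfl⟩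
  | instr c σ => cases h'; exact ⟨rfl, rfl⟩
  | seq _ _ ih₁ ih₂ =>
    cases h' with
    | seq h₁ h₂ =>
      obtain ⟨rfl, rfl⟩ := ih₁ h₁
      obtain ⟨rfl, rfl⟩ := ih₂ h₂
      exact ⟨rfl, rfl⟩
  | ifTrue h _ ih =>
    cases h' with
    | ifTrue _ h₁ => obtain ⟨rfl, rfl⟩ := ih h₁; exact ⟨rfl, rfl⟩
    | ifFalse h₀ _ => exact absurd h₀ h
  | ifFalse h _ ih =>
    cases h' with
    | ifTrue h₀ _ => exact absurd h h₀
    | ifFalse _ h₁ => obtain ⟨rfl, rfl⟩ := ih h₁; exact ⟨rfl, rfl⟩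
  | whileTrue h _ _ ih₁ ih₂ =>
    cases h' with
    | whileTrue _ h₁ h₂ =>
      obtain ⟨rfl, rfl⟩ := ih₁ h₁
      obtain ⟨rfl, rfl⟩ := ih₂ h₂
      exact ⟨rfl, rfl⟩
    | whileFalse h₀ => exact absurd h₀ h
  | whileFalse h =>
    cases h' with
    | whileTrue h₀ _ _ => exact absurd h h₀
    | whileFalse _ => exact ⟨rfl, rfl⟩

end RAM

/-! ### Solving CCTO on the machine -/

/-- A cost as a machine word: `0` for infinite cost and `c + 1` for the finite cost `c`. -/
def encodeCost (c : ℕ∞) : ℕ := if c = ⊤ then 0 else c.toNat + 1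

namespace CCTOInstance

/-- The cost function of the input as a table of machine words; it contains `0` wherever the
arguments are not vertices and time steps. -/
def table (I : CCTOInstance) (u v p q : ℕ) : ℕ :=
  if h : (u < I.n ∧ v < I.n) ∧ (p < I.T ∧ q < I.T) then
    encodeCost (I.G.cost ⟨u, h.1.1⟩ ⟨v, h.1.2⟩ ⟨p, h.2.1⟩ ⟨q, h.2.2⟩)
  else 0

/-- The start of a computation: registers `0` to `5` hold the six numbers of the input, everything
else is `0`. -/
def initialState (I : CCTOInstance) : RAM.State where
  reg
    | 0 => I.n
    | 1 => I.T
    | 2 => I.k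
    | 3 => I.budget
    | 4 => I.source
    | 5 => I.sink
    | _ => 0
  arr := fun _ _ => 0

open Classical in
/-- On the input `I`, the program `P` halts after exactly `t` steps, with the correct answer
(`1` for yes and `0` for no) in register `0`. -/
def SolvedInSteps (I : CCTOInstance) (P : RAM.Program) (t : ℕ) : Prop :=
  ∃ τ : RAM.State, RAM.Run I.table P I.initialState t τ ∧ τ.reg 0 = if I.IsYes then 1 else 0

end CCTOInstance

/-- CCTO is fixed-parameter tractable with parameter `k`: one program solves all inputs in at most
`g(k) · size ^ c` steps, for a computable function `g` and a constant `c`. -/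
def CCTOFixedParameterTractable : Prop :=
  ∃ (P : RAM.Program) (g : ℕ → ℕ) (c : ℕ), Computable g ∧
    ∀ I : CCTOInstance, ∃ t : ℕ, I.SolvedInSteps P t ∧ t ≤ g I.k * I.size ^ c

/-!
The algorithm is colour coding, made deterministic by a small family of hash functions.

*Reduction to labels.* Give every vertex a label in `0, …, k`, and follow a walk while counting how
far it has met the labels `1, 2, 3, …` in this order (`advance`). A walk that gets to `k` has visited
`k` distinct vertices, whatever the labels are (`CCTOInstance.isYes_of_accepts`). Conversely, if `k`
distinct vertices of a walk are labelled `1, …, k` in an order in which the walk meets them, then the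
walk gets to `k`, whatever the labels of the other vertices are (`le_foldl_advance`,
`CCTOInstance.exists_list_of_isYes`).

*The labellings.* The vertex `v` has the colour `(a v mod p) mod (k² + 1)`, and a sequence of `k`
colours, written as a number with `k` digits in base `k² + 1`, lists the colours that get the labels
`1, …, k`. There are at most `2n · 2n · (k² + 1) ^ k` choices with `n ≤ p ≤ 2n` and `a < p`. Some `p`
among them is a prime greater than `n`, and then some `a` gives different colours to any `k` given
vertices (`exists_injOn_mul_mod_mod`); so one of the labellings is as wanted
(`CCTOInstance.isYes_iff`). All moduli are tried, so that no prime has to be found.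

*One labelling.* For each progress `i ≤ k` and each node, that is, each pair of a vertex and a time
step, a table holds the largest part of the budget that can be left when this node is reached with
this progress. Because waiting is free, it suffices to consider walks whose moves follow each other
without gaps from the first to the last time step. As every move takes time, `T` rounds of trying all
moves suffice (`CCTOInstance.BudgetComplete.succ`, `CCTOInstance.accepts_iff`); a round takes
`O(k (n T)²)` steps. Over all labellings this is `k ^ O(k) · n⁴ T³`.

*The machine.* `RAM.Spec` bounds the number of steps of a program and describes the state in which it
halts. Programs are built from straight-line code, conditionals and counting loops, and `Run.frame`
reads off from the text of a program which registers and arrays it leaves alone. There is no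
multiplication or division: products are repeated sums, the multiples of `a` modulo `p` are computed
one after the other, and all quotients and remainders modulo `k² + 1` and `T` come from tables that
are filled by counting.
-/

/-! ### Reasoning about programs: cost, frame and loops -/

namespace RAM

/-- Register holding the constant `1`. -/
notation "r_one" => (6 : ℕ)
/-- Register holding the constant `0`. -/
notation "r_zero" => (7 : ℕ)

/-- Whether an instruction assigns register `r`. -/
def Instr.modReg : Instr → ℕ → Bool
  | const i _, r => r == i
  | add i _ _, r => r == i
  | sub i _ _, r => r == i
  | load i _ _, r => r == i
  | store _ _ _, _ => false
  | lookup i _ _ _ _, r => r == i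

/-- Whether an instruction assigns an entry of array `a`. -/
def Instr.modArr : Instr → ℕ → Bool
  | store b _ _, a => a == b
  | _, _ => false

/-- Whether register `r` is assigned anywhere in the text of a program. -/
def Program.modReg : Program → ℕ → Bool
  | skip, _ => false
  | instr c, r => c.modReg r
  | seq P Q, r => P.modReg r || Q.modReg r
  | ifNonzero _ P Q, r => P.modReg r || Q.modReg r
  | whileNonzero _ P, r => P.modReg r

/-- Whether array `a` is assigned anywhere in the text of a program. -/
def Program.modArr : Program → ℕ → Bool
  | skip, _ => false
  | instr c, a => c.modArr a
  | seq P Q, a => P.modArr a || Q.modArr a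
  | ifNonzero _ P Q, a => P.modArr a || Q.modArr a
  | whileNonzero _ P, a => P.modArr a

/-- `τ` agrees with `σ` on all registers and arrays that the text of `P` does not assign. -/
def Program.Frame (P : Program) (σ τ : State) : Prop :=
  (∀ r, P.modReg r = false → τ.reg r = σ.reg r) ∧ ∀ a, P.modArr a = false → τ.arr a = σ.arr a

variable {F : ℕ → ℕ → ℕ → ℕ → ℕ}

theorem Instr.reg_exec {c : Instr} {σ : State} {r : ℕ} (h : c.modReg r = false) :
    (c.exec F σ).reg r = σ.reg r := by
  cases c <;> simp_all [Instr.modReg, Instr.exec, State.setReg, State.setArr]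

theorem Instr.arr_exec {c : Instr} {σ : State} {a : ℕ} (h : c.modArr a = false) :
    (c.exec F σ).arr a = σ.arr a := by
  cases c <;> simp_all [Instr.modArr, Instr.exec, State.setReg, State.setArr]

theorem Run.frame {P : Program} {σ τ : State} {t : ℕ} (h : Run F P σ t τ) : P.Frame σ τ := by
  induction h with
  | skip σ => exact ⟨fun _ _ => rfl, fun _ _ => rfl⟩
  | instr c σ => exact ⟨fun _ h => Instr.reg_exec h, fun _ h => Instr.arr_exec h⟩
  | seq _ _ ih₁ ih₂ =>
    refine ⟨fun r hr => ?_, fun a ha => ?_⟩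
    · simp only [Program.modReg, Bool.or_eq_false_iff] at hr
      rw [ih₂.1 r hr.2, ih₁.1 r hr.1]
    · simp only [Program.modArr, Bool.or_eq_false_iff] at ha
      rw [ih₂.2 a ha.2, ih₁.2 a ha.1]
  | ifTrue _ _ ih =>
    refine ⟨fun r hr => ?_, fun a ha => ?_⟩
    · simp only [Program.modReg, Bool.or_eq_false_iff] at hr
      exact ih.1 r hr.1
    · simp only [Program.modArr, Bool.or_eq_false_iff] at ha
      exact ih.2 a ha.1
  | ifFalse _ _ ih =>
    refine ⟨fun r hr => ?_, fun a ha => ?_⟩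
    · simp only [Program.modReg, Bool.or_eq_false_iff] at hr
      exact ih.1 r hr.2
    · simp only [Program.modArr, Bool.or_eq_false_iff] at ha
      exact ih.2 a ha.2
  | whileTrue _ _ _ ih₁ ih₂ =>
    refine ⟨fun r hr => ?_, fun a ha => ?_⟩
    · rw [ih₂.1 r hr, ih₁.1 r hr]
    · rw [ih₂.2 a ha, ih₁.2 a ha]
  | whileFalse _ => exact ⟨fun _ _ => rfl, fun _ _ => rfl⟩

/-- Started in `σ`, the program `P` halts after at most `c` steps in a state satisfying `B`. -/
def Spec (F : ℕ → ℕ → ℕ → ℕ → ℕ) (P : Program) (σ : State) (c : ℕ) (B : State → Prop) : Prop :=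
  ∃ t τ, Run F P σ t τ ∧ t ≤ c ∧ B τ

theorem Spec.weaken {P : Program} {σ : State} {c c' : ℕ} {B B' : State → Prop}
    (h : Spec F P σ c B) (hc : c ≤ c') (hB : ∀ τ, P.Frame σ τ → B τ → B' τ) :
    Spec F P σ c' B' := by
  obtain ⟨t, τ, hr, ht, hb⟩ := h
  exact ⟨t, τ, hr, ht.trans hc, hB τ hr.frame hb⟩

theorem Spec.seq {P Q : Program} {σ : State} {c c' : ℕ} {B C : State → Prop}
    (h : Spec F P σ c B) (h' : ∀ τ, P.Frame σ τ → B τ → Spec F Q τ c' C) :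
    Spec F (P.seq Q) σ (c + c') C := by
  obtain ⟨t, τ, hr, ht, hb⟩ := h
  obtain ⟨t', υ, hr', ht', hc⟩ := h' τ hr.frame hb
  exact ⟨t + t', υ, hr.seq hr', by omega, hc⟩

theorem Spec.ifNonzero {i : ℕ} {P Q : Program} {σ : State} {c : ℕ} {B : State → Prop}
    (h : σ.reg i ≠ 0 → Spec F P σ c B) (h' : σ.reg i = 0 → Spec F Q σ c B) :
    Spec F (Program.ifNonzero i P Q) σ (c + 1) B := by
  by_cases hi : σ.reg i = 0
  · obtain ⟨t, τ, hr, ht, hb⟩ := h' hi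
    exact ⟨t + 1, τ, .ifFalse hi hr, by omega, hb⟩
  · obtain ⟨t, τ, hr, ht, hb⟩ := h hi
    exact ⟨t + 1, τ, .ifTrue hi hr, by omega, hb⟩

/-- Straight-line programs. -/
def block : List Instr → Program
  | [] => .skip
  | c :: l => .seq (.instr c) (block l)

theorem Spec.block {l : List Instr} {σ : State} {B : State → Prop}
    (h : B (l.foldl (fun σ c => c.exec F σ) σ)) : Spec F (block l) σ l.length B := by
  induction l generalizing σ with
  | nil => exact ⟨0, σ, .skip σ, le_rfl, h⟩
  | cons c l ih =>
    obtain ⟨t, τ, hr, ht, hb⟩ := ih h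
    exact ⟨1 + t, τ, (Run.instr c σ).seq hr, by simp only [List.length_cons]; omega, hb⟩

/-- Run `P` with register `i` counting from `0` up to, excluding, the content of register `b`.
Register `c` counts down the remaining rounds. -/
def forLoop (i c b : ℕ) (P : Program) : Program :=
  .seq (block [.add c b r_zero, .const i 0])
    (.whileNonzero c (.seq P (block [.add i i r_one, .sub c c r_one])))

/-- Two states that differ at most in the registers `i` and `c`; loop invariants are required to be
indifferent to the two counters of the loop. -/
def State.EqOff (i c : ℕ) (τ τ' : State) : Prop :=
  (∀ r, r ≠ i → r ≠ c → τ'.reg r = τ.reg r) ∧ τ'.arr = τ.arr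

theorem Spec.forLoop {i c b N K : ℕ} {P : Program} {σ : State} (Inv : ℕ → State → Prop)
    (hb : σ.reg b = N) (h1 : σ.reg r_one = 1) (h0 : σ.reg r_zero = 0)
    (hregs : i ≠ c ∧ i ≠ r_one ∧ c ≠ r_one ∧
      P.modReg i = false ∧ P.modReg c = false ∧ P.modReg r_one = false)
    (hstable : ∀ j τ τ', Inv j τ → State.EqOff i c τ τ' → Inv j τ')
    (hinit : Inv 0 σ)
    (hstep : ∀ j < N, ∀ τ, τ.reg i = j → (forLoop i c b P).Frame σ τ → Inv j τ →
      Spec F P τ K (Inv (j + 1))) :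
    Spec F (forLoop i c b P) σ (N * (K + 3) + 3) (Inv N) := by
  obtain ⟨hic, hi1, hc1, hPi, hPc, hP1⟩ := hregs
  have hmod1 : (RAM.forLoop i c b P).modReg r_one = false := by
    simp [RAM.forLoop, RAM.block, Program.modReg, Instr.modReg, hP1, hi1.symm, hc1.symm]
  -- Induction on the number `d` of remaining rounds.
  have key : ∀ d j τ, j + d = N → τ.reg i = j → τ.reg c = d → (RAM.forLoop i c b P).Frame σ τ →
      Inv j τ → Spec F (.whileNonzero c (.seq P (RAM.block [.add i i r_one, .sub c c r_one]))) τ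
        (d * (K + 3) + 1) (Inv N) := by
    intro d
    induction d with
    | zero =>
      intro j τ hj _ hc _ hinv
      obtain rfl : j = N := by omega
      exact ⟨1, τ, .whileFalse hc, by omega, hinv⟩
    | succ d ih =>
      intro j τ hj hi hc hfr hinv
      obtain ⟨t, υ, hr, ht, hb'⟩ := hstep j (by omega) τ hi hfr hinv
      have hfr' := hr.frame
      have hui : υ.reg i = j := by rw [hfr'.1 i hPi, hi]
      have huc : υ.reg c = d + 1 := by rw [hfr'.1 c hPc, hc]
      have hu1 : υ.reg r_one = 1 := by rw [hfr'.1 _ hP1, hfr.1 _ hmod1, h1]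
      obtain ⟨t', ω, hr', ht', hω⟩ := Spec.block (F := F) (σ := υ)
        (l := [.add i i r_one, .sub c c r_one])
        (B := fun ω => ω.reg i = j + 1 ∧ ω.reg c = d ∧ State.EqOff i c υ ω) (by
          simp only [List.foldl_cons, List.foldl_nil, Instr.exec, State.setReg, State.EqOff]
          refine ⟨?_, ?_, ?_, trivial⟩
          · simp [hic, hui, hu1]
          · simp [hic.symm, huc, hi1.symm, hu1]
          · intro r h h'
            simp [h, h'])
      have hrun := hr.seq hr'
      have hfr2 : (RAM.forLoop i c b P).Frame σ ω := by
        have h2 := hrun.frame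
        refine ⟨fun r hr => ?_, fun a ha => ?_⟩
        · rw [h2.1 r, hfr.1 r hr]
          simp only [RAM.forLoop, Program.modReg, Bool.or_eq_false_iff] at hr ⊢
          exact hr.2
        · rw [h2.2 a, hfr.2 a ha]
          simp only [RAM.forLoop, Program.modArr, Bool.or_eq_false_iff] at ha ⊢
          exact ha.2
      obtain ⟨t2, υ2, hr2, ht2, hb2⟩ := ih (j + 1) ω (by omega) hω.1 hω.2.1 hfr2
        (hstable _ _ _ hb' hω.2.2)
      refine ⟨t + t' + t2 + 1, υ2, .whileTrue (by omega) hrun hr2, ?_, hb2⟩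
      simp only [List.length_cons, List.length_nil] at ht'
      rw [Nat.succ_mul]
      omega
  have hblock := Spec.block (F := F) (σ := σ) (l := [.add c b r_zero, .const i 0])
    (B := fun ω => ω.reg i = 0 ∧ ω.reg c = N ∧ State.EqOff i c σ ω) (by
      simp only [List.foldl_cons, List.foldl_nil, Instr.exec, State.setReg, State.EqOff]
      refine ⟨by simp, by simp [hic.symm, hb, h0], ?_, trivial⟩
      intro r h h'
      simp [h, h'])
  refine (hblock.seq fun τ hfr hτ => key N 0 τ (by omega) hτ.1 hτ.2.1 ?_
    (hstable _ _ _ hinit hτ.2.2)).weaken ?_ fun _ _ h => h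
  · refine ⟨fun r hr => hfr.1 r ?_, fun a ha => hfr.2 a ?_⟩
    · simp only [RAM.forLoop, Program.modReg, Bool.or_eq_false_iff] at hr
      exact hr.1
    · simp only [RAM.forLoop, Program.modArr, Bool.or_eq_false_iff] at ha
      exact ha.1
  · simp only [List.length_cons, List.length_nil]
    omega

/-- The loop rule with the cost in product form: a body of cost `K * X`, repeated at most `N'`
times, costs at most `(K + 6) * (N' * X)`. -/
theorem Spec.forLoop_mul {i c b N N' K X : ℕ} {P : Program} {σ : State}
    (Inv : ℕ → State → Prop) (hN : N ≤ N') (hN' : 0 < N') (hX : 0 < X)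
    (hb : σ.reg b = N) (h1 : σ.reg r_one = 1) (h0 : σ.reg r_zero = 0)
    (hregs : i ≠ c ∧ i ≠ r_one ∧ c ≠ r_one ∧
      P.modReg i = false ∧ P.modReg c = false ∧ P.modReg r_one = false)
    (hstable : ∀ j τ τ', Inv j τ → State.EqOff i c τ τ' → Inv j τ')
    (hinit : Inv 0 σ)
    (hstep : ∀ j < N, ∀ τ, τ.reg i = j → (RAM.forLoop i c b P).Frame σ τ → Inv j τ →
      Spec F P τ (K * X) (Inv (j + 1))) :
    Spec F (RAM.forLoop i c b P) σ ((K + 6) * (N' * X)) (Inv N) := by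
  refine (Spec.forLoop Inv hb h1 h0 hregs hstable hinit hstep).weaken ?_ fun _ _ h => h
  have e1 : N * (K * X + 3) ≤ N' * (K * X + 3) := Nat.mul_le_mul_right _ hN
  have e2 : N' ≤ N' * X := Nat.le_mul_of_pos_right _ hX
  have e3 : (K + 6) * (N' * X) = N' * (K * X) + 6 * (N' * X) := by ring
  have e4 : N' * (K * X + 3) = N' * (K * X) + 3 * N' := by ring
  rw [e3]
  rw [e4] at e1
  omega

end RAM

/-! ### Multiplicative hashing -/

/-- The map `x ↦ (a x mod p) mod (k² + 1)` is injective on a given set of `k` residues for some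
multiplier `a`: a pair of distinct residues collides for at most `(p - 1) / (k² + 1)` multipliers on
either side, so all pairs together spoil fewer than `p - 1` multipliers. -/
theorem exists_injOn_mul_mod_mod {p k : ℕ} (hp : p.Prime) (S : Finset ℕ) (hS : ∀ x ∈ S, x < p)
    (hk : S.card ≤ k) : ∃ a < p, Set.InjOn (fun x => a * x % p % (k * k + 1)) S := by
  classical
  have := Fact.mk hp
  by_contra hcon
  push Not at hcon
  set m := k * k + 1 with hm
  -- The multipliers that make `z.1` and `z.2` collide, with the larger residue at `z.1`.
  set B : ℕ × ℕ → Finset ℕ := fun z => (Finset.Icc 1 (p - 1)).filter fun a =>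
    a * z.2 % p < a * z.1 % p ∧ a * z.2 % p ≡ a * z.1 % p [MOD m] with hB
  have hcover : Finset.Icc 1 (p - 1) ⊆ (S ×ˢ S).biUnion B := by
    intro a ha
    have hap : a < p := by
      have := Finset.mem_Icc.1 ha
      have := hp.two_le
      omega
    have hninj := hcon a hap
    simp only [Set.InjOn, not_forall] at hninj
    obtain ⟨x, hx, y, hy, hxy, hne⟩ := hninj
    have hx' : x ∈ S := hx
    have hy' : y ∈ S := hy
    have hne' : a * x % p ≠ a * y % p := by
      intro h
      have hca : Nat.Coprime p a := by
        refine (Nat.Prime.coprime_iff_not_dvd hp).2 fun hd => ?_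
        have := Nat.le_of_dvd (by have := Finset.mem_Icc.1 ha; omega) hd
        omega
      have := Nat.ModEq.cancel_left_of_coprime hca h
      exact hne (Nat.ModEq.eq_of_lt_of_lt this (hS x hx') (hS y hy'))
    rcases lt_or_gt_of_ne hne' with h | h
    · exact Finset.mem_biUnion.2 ⟨(y, x), Finset.mem_product.2 ⟨hy', hx'⟩,
        Finset.mem_filter.2 ⟨ha, h, hxy⟩⟩
    · exact Finset.mem_biUnion.2 ⟨(x, y), Finset.mem_product.2 ⟨hx', hy'⟩,
        Finset.mem_filter.2 ⟨ha, h, hxy.symm⟩⟩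
  have hcard : ∀ z ∈ S ×ˢ S, (B z).card ≤ (p - 1) / m := by
    rintro ⟨x, y⟩ hz
    obtain ⟨hx, hy⟩ := Finset.mem_product.1 hz
    have hpp := hp.pos
    -- The quotient by `m` of the difference of the residues determines the multiplier.
    have h1 : (B (x, y)).card ≤ (Finset.Icc 1 ((p - 1) / m)).card := by
      refine Finset.card_le_card_of_injOn (fun a => (a * x % p - a * y % p) / m) ?_ ?_
      · intro a ha
        obtain ⟨-, hlt, hmod⟩ := Finset.mem_filter.1 ha
        have hd : m ∣ a * x % p - a * y % p := (Nat.modEq_iff_dvd' hlt.le).1 hmod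
        have hxp := Nat.mod_lt (a * x) hpp
        refine Finset.mem_coe.2 (Finset.mem_Icc.2 ⟨?_, ?_⟩)
        · exact Nat.div_pos (Nat.le_of_dvd (by simp only at hlt; omega) hd) (by omega)
        · exact Nat.div_le_div_right (by omega)
      · intro a ha b hb hab
        obtain ⟨ha1, hlt, hmod⟩ := Finset.mem_filter.1 ha
        obtain ⟨hb1, hlt', hmod'⟩ := Finset.mem_filter.1 hb
        simp only at hlt hlt' hmod hmod' hab
        have hd : m ∣ a * x % p - a * y % p := (Nat.modEq_iff_dvd' hlt.le).1 hmod
        have hd' : m ∣ b * x % p - b * y % p := (Nat.modEq_iff_dvd' hlt'.le).1 hmod'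
        have heq : a * x % p - a * y % p = b * x % p - b * y % p := by
          rw [← Nat.div_mul_cancel hd, hab, Nat.div_mul_cancel hd']
        have heq' : a * x % p + b * y % p = b * x % p + a * y % p := by omega
        have hz : ((a : ZMod p) - b) * ((x : ZMod p) - y) = 0 := by
          have := congrArg (Nat.cast : ℕ → ZMod p) heq'
          push_cast [ZMod.natCast_mod] at this
          linear_combination this
        have hxy : (x : ZMod p) - y ≠ 0 := by
          intro h
          rw [sub_eq_zero, ZMod.natCast_eq_natCast_iff] at h
          have := Nat.ModEq.eq_of_lt_of_lt h (hS x hx) (hS y hy)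
          subst this
          exact lt_irrefl _ hlt
        have hab' := (mul_eq_zero.1 hz).resolve_right hxy
        rw [sub_eq_zero, ZMod.natCast_eq_natCast_iff] at hab'
        have ha2 := Finset.mem_Icc.1 ha1
        have hb2 := Finset.mem_Icc.1 hb1
        exact Nat.ModEq.eq_of_lt_of_lt hab' (by omega) (by omega)
    simpa using h1
  have h1 := Finset.card_le_card hcover
  have h2 := (Finset.card_biUnion_le (s := S ×ˢ S) (t := B)).trans (Finset.sum_le_card_nsmul _ _ _ hcard)
  rw [Finset.card_product, smul_eq_mul] at h2
  rw [Nat.card_Icc] at h1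
  have h3 : S.card * S.card * ((p - 1) / m) ≤ k * k * ((p - 1) / m) :=
    Nat.mul_le_mul_right _ (Nat.mul_le_mul hk hk)
  have h4 : m * ((p - 1) / m) ≤ p - 1 := Nat.mul_div_le _ _
  have h5 := hp.two_le
  have h6 : m * ((p - 1) / m) = k * k * ((p - 1) / m) + (p - 1) / m := by rw [hm]; ring
  have h7 : 0 < (p - 1) / m := by
    rcases Nat.eq_zero_or_pos ((p - 1) / m) with h | h
    · rw [h] at h3 h2
      omega
    · exact h
  omega

/-! ### Labelled vertices and the progress of a walk -/

/-- The progress of a walk that enters `v` after having met the labels `1, …, i` in this order. -/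
def advance (L : ℕ → ℕ) (i v : ℕ) : ℕ := if L v = i + 1 then i + 1 else i

theorem le_advance (L : ℕ → ℕ) (i v : ℕ) : i ≤ advance L i v := by
  unfold advance; split <;> omega

theorem advance_le {L : ℕ → ℕ} {k i v : ℕ} (hL : L v ≤ k) (hi : i ≤ k) : advance L i v ≤ k := by
  unfold advance; split <;> omega

theorem advance_advance (L : ℕ → ℕ) (i v : ℕ) :
    advance L (advance L i v) v = advance L i v := by
  unfold advance; split <;> simp_all

theorem foldl_advance_le {L : ℕ → ℕ} {k : ℕ} (hL : ∀ v, L v ≤ k) (vs : List ℕ) {i : ℕ}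
    (hi : i ≤ k) : vs.foldl (advance L) i ≤ k := by
  induction vs generalizing i with
  | nil => exact hi
  | cons v vs ih => exact ih (advance_le (hL v) hi)

/-- Vertices labelled `b + 1, b + 2, …` that are met in this order raise the progress as intended,
no matter which other vertices, however labelled, are met in between. -/
theorem le_foldl_advance {L : ℕ → ℕ} {Z vs : List ℕ} (h : Z.Sublist vs) :
    ∀ b i, b ≤ i → (∀ j (hj : j < Z.length), L Z[j] = b + j + 1) →
      b + Z.length ≤ vs.foldl (advance L) i := by
  induction h with
  | slnil => intro b i hb _; simpa using hb
  | cons v _ ih => intro b i hb hZ; exact ih b _ (hb.trans (le_advance L i v)) hZ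
  | @cons_cons Z vs v _ ih =>
    intro b i hb hZ
    have h0 : L v = b + 0 + 1 := hZ 0 (by simp)
    have := ih (b + 1) (advance L i v) (by unfold advance; split <;> omega) (by
      intro j hj
      have := hZ (j + 1) (by simpa using hj)
      simp only [List.getElem_cons_succ] at this
      omega)
    simp only [List.length_cons, List.foldl_cons]
    omega

/-- `Reach F L s r i v t c`: with the table `F`, some walk from `s` with `r` moves, waiting moves
included, is at `v` at time `t`, has cost `c` and progress `i` with respect to the labels `L`. The
table holds `0` for infinite cost and `w + 1` for cost `w`. -/
inductive Reach (F : ℕ → ℕ → ℕ → ℕ → ℕ) (L : ℕ → ℕ) (s : ℕ) : ℕ → ℕ → ℕ → ℕ → ℕ → Prop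
  | start : Reach F L s 0 (advance L 0 s) s 0 0
  | step {r i u t c v t' w : ℕ} (h : Reach F L s r i u t c) (hw : F u v t t' = w + 1) :
      Reach F L s (r + 1) (advance L i v) v t' (c + w)

theorem Reach.advance_eq {F : ℕ → ℕ → ℕ → ℕ → ℕ} {L : ℕ → ℕ} {s r i v t c : ℕ}
    (h : Reach F L s r i v t c) : advance L i v = i := by
  cases h <;> exact advance_advance _ _ _

namespace CCTOInstance

variable (I : CCTOInstance)

theorem table_eq_succ {u v t t' w : ℕ} (h : I.table u v t t' = w + 1) :
    ∃ (hu : u < I.n) (hv : v < I.n) (ht : t < I.T) (ht' : t' < I.T),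
      t < t' ∧ I.G.cost ⟨u, hu⟩ ⟨v, hv⟩ ⟨t, ht⟩ ⟨t', ht'⟩ = (w : ℕ∞) := by
  unfold table at h
  split at h
  · rename_i hh
    refine ⟨hh.1.1, hh.1.2, hh.2.1, hh.2.2, ?_⟩
    unfold encodeCost at h
    split at h
    · simp at h
    · rename_i hne
      refine ⟨?_, ?_⟩
      · by_contra hlt
        exact hne (I.G.cost_eq_top _ _ _ _ (by simpa using hlt))
      · rw [← ENat.natCast_toNat hne]
        congr 1
        omega
  · simp at h

theorem table_of_cost {u v : Fin I.n} {t t' : Fin I.T} (h : I.G.cost u v t t' < ⊤) :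
    I.table u v t t' = (I.G.cost u v t t').toNat + 1 := by
  simp [table, encodeCost, h.ne]

/-- Soundness of `Reach`: it comes with a walk, which has visited a vertex for each of the labels
`1, …, i`. -/
theorem exists_walk_of_reach {L : ℕ → ℕ} {r i v t c : ℕ}
    (h : Reach I.table L I.source r i v t c) :
    ∃ (hv : v < I.n) (W : List (TimedMove (Fin I.n) I.T)), t < I.T ∧ r ≤ t ∧ I.G.IsValidWalk W ∧
      WalkFromTo I.source ⟨v, hv⟩ W ∧ (∀ q ∈ W.getLast?, (q.arr : ℕ) ≤ t) ∧
      I.G.walkCost W = (c : ℕ∞) ∧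
      ∀ j, 1 ≤ j → j ≤ i → ∃ x ∈ visited I.source W, L x = j := by
  induction h with
  | start =>
    refine ⟨I.source.2, [], I.T_pos, le_rfl, ⟨by simp, by simp⟩, Or.inl ⟨rfl, rfl⟩, by simp,
      by simp [TemporalCostGraph.walkCost], fun j hj hj' => ⟨I.source, Or.inl rfl, ?_⟩⟩
    unfold advance at hj'
    split at hj' <;> omega
  | @step r i u t c v t' w _ hw ih =>
    obtain ⟨hu, W, ht, hrt, hW, hft, hlast, hcost, hlab⟩ := ih
    obtain ⟨_, hv, _, ht', htt, hc⟩ := I.table_eq_succ hw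
    refine ⟨hv, W ++ [⟨⟨u, hu⟩, ⟨v, hv⟩, ⟨t, ht⟩, ⟨t', ht'⟩⟩], ht', by omega, ⟨?_, ?_⟩, ?_, ?_, ?_, ?_⟩
    · refine List.isChain_append.2 ⟨hW.1, by simp, ?_⟩
      intro x hx y hy
      obtain rfl : _ = y := by simpa using hy
      refine ⟨?_, Fin.le_def.2 (hlast x hx)⟩
      rcases hft with ⟨rfl, -⟩ | ⟨-, q, hq, hqd⟩
      · simp at hx
      · rw [Option.mem_def, hq] at hx
        cases hx
        exact hqd
    · intro q hq
      rcases List.mem_append.1 hq with hq | hq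
      · exact hW.2 q hq
      · obtain rfl := List.mem_singleton.1 hq
        exact ⟨htt, by rw [hc]; exact ENat.natCast_lt_top _⟩
    · right
      refine ⟨?_, by simp⟩
      rcases hft with ⟨rfl, hs⟩ | ⟨⟨q, hq, hqs⟩, -⟩
      · exact ⟨_, rfl, hs.symm⟩
      · exact ⟨q, by rw [List.head?_append, hq]; rfl, hqs⟩
    · simp
    · have := congrArg (· + (w : ℕ∞)) hcost
      simp only [TemporalCostGraph.walkCost] at this
      simp [TemporalCostGraph.walkCost, hc, this]
    · intro j hj hj'
      by_cases hji : j ≤ i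
      · obtain ⟨x, hx, hxL⟩ := hlab j hj hji
        refine ⟨x, ?_, hxL⟩
        rcases hx with hx | ⟨q, hq, hx⟩
        · exact Or.inl hx
        · exact Or.inr ⟨q, List.mem_append_left _ hq, hx⟩
      · refine ⟨⟨v, hv⟩, Or.inr ⟨_, List.mem_append_right _ (List.mem_singleton_self _), Or.inr rfl⟩,
          ?_⟩
        unfold advance at hj'
        simp only
        split at hj' <;> omega

/-- The walks found with the help of labels `L` answer the question of CCTO positively. -/
def Accepts (L : ℕ → ℕ) : Prop :=
  ∃ r c, Reach I.table L I.source r I.k I.sink (I.T - 1) c ∧ c ≤ I.budget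

theorem isYes_of_accepts {L : ℕ → ℕ} (h : I.Accepts L) : I.IsYes := by
  obtain ⟨r, c, h, hc⟩ := h
  obtain ⟨_, W, -, -, hW, hft, -, hcost, hlab⟩ := I.exists_walk_of_reach h
  refine ⟨W, hW, hft, ?_, by rw [hcost]; exact_mod_cast hc⟩
  have hsub : (Finset.Icc 1 I.k : Set ℕ) ⊆ (fun x : Fin I.n => L x) '' visited I.source W := by
    intro j hj
    obtain ⟨hj1, hj2⟩ := Finset.mem_Icc.1 (Finset.mem_coe.1 hj)
    obtain ⟨x, hx, hxL⟩ := hlab j hj1 hj2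
    exact ⟨x, hx, hxL⟩
  calc I.k = (Finset.Icc 1 I.k : Set ℕ).ncard := by rw [Set.ncard_coe_finset]; simp
    _ ≤ _ := Set.ncard_le_ncard hsub (Set.toFinite _)
    _ ≤ _ := Set.ncard_image_le (Set.toFinite _)

/-- Waiting at a vertex is free. -/
theorem reach_wait {L : ℕ → ℕ} {r i v t t' c : ℕ} (h : Reach I.table L I.source r i v t c)
    (htt : t ≤ t') (ht' : t' < I.T) : ∃ r', Reach I.table L I.source r' i v t' c := by
  rcases htt.eq_or_lt with rfl | hlt
  · exact ⟨r, h⟩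
  · obtain ⟨hv, _, ht, -⟩ := I.exists_walk_of_reach h
    have hc := I.G.cost_self ⟨v, hv⟩ ⟨t, ht⟩ ⟨t', ht'⟩ hlt
    have htab := I.table_of_cost (u := ⟨v, hv⟩) (v := ⟨v, hv⟩) (t := ⟨t, ht⟩) (t' := ⟨t', ht'⟩)
      (by rw [hc]; exact ENat.top_pos)
    rw [hc] at htab
    have := h.step (v := v) (t' := t') (w := 0) htab
    rw [h.advance_eq] at this
    exact ⟨_, this⟩

/-- Completeness of `Reach`: a valid walk extends what is reached so far; waiting moves fill the gaps
between its moves and the time after its last move. -/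
theorem reach_of_walk {L : ℕ → ℕ} (W : List (TimedMove (Fin I.n) I.T)) {r i u t c : ℕ}
    (h : Reach I.table L I.source r i u t c) (hW : I.G.IsValidWalk W)
    (hhead : ∀ q ∈ W.head?, (q.src : ℕ) = u ∧ t ≤ q.dep) :
    ∃ r' c' : ℕ, I.G.walkCost W = (c' : ℕ∞) ∧
      Reach I.table L I.source r' ((W.map fun q => (q.dst : ℕ)).foldl (advance L) i)
        ((W.map fun q => (q.dst : ℕ)).getLastD u) (I.T - 1) (c + c') := by
  induction W generalizing r i u t c with
  | nil =>
    obtain ⟨_, _, ht, -⟩ := I.exists_walk_of_reach h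
    obtain ⟨r', h'⟩ := I.reach_wait h (t' := I.T - 1) (by omega) (by omega)
    exact ⟨r', 0, by simp [TemporalCostGraph.walkCost], by simpa using h'⟩
  | cons q W ih =>
    obtain ⟨rfl, htq⟩ := hhead q (by simp)
    obtain ⟨r₁, h₁⟩ := I.reach_wait h htq q.dep.2
    obtain ⟨hlt, hfin⟩ := hW.2 q (by simp)
    have h₂ := h₁.step (I.table_of_cost hfin)
    have hc := List.isChain_cons.1 hW.1
    obtain ⟨r₃, c₃, hc₃, h₃⟩ := ih h₂ ⟨hc.2, fun q' hq' => hW.2 q' (by simp [hq'])⟩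
      (fun q' hq' => ⟨congrArg Fin.val (hc.1 q' hq').1.symm, Fin.le_def.1 (hc.1 q' hq').2⟩)
    refine ⟨r₃, (I.G.cost q.src q.dst q.dep q.arr).toNat + c₃, ?_, ?_⟩
    · unfold TemporalCostGraph.walkCost at hc₃ ⊢
      rw [List.map_cons, List.sum_cons, hc₃]
      push_cast
      rw [ENat.natCast_toNat hfin.ne]
    · rw [← add_assoc]
      rw [List.map_cons, List.foldl_cons, List.getLastD_cons]
      exact h₃

theorem visited_subset {G : TemporalCostGraph (Fin I.n) I.T} (W : List (TimedMove (Fin I.n) I.T))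
    {s : Fin I.n} (hW : G.IsValidWalk W) (hs : ∀ q ∈ W.head?, q.src = s) :
    visited s W ⊆ {x | x ∈ s :: W.map TimedMove.dst} := by
  induction W generalizing s with
  | nil =>
    rintro x (rfl | ⟨q, hq, -⟩)
    · simp
    · simp at hq
  | cons q W ih =>
    have hc := List.isChain_cons.1 hW.1
    have ih' := ih (s := q.dst) ⟨hc.2, fun q' hq' => hW.2 q' (by simp [hq'])⟩
      (fun q' hq' => ((hc.1 q' hq').1).symm)
    rintro x (rfl | ⟨q', hq', hx⟩)
    · simp
    · rcases List.mem_cons.1 hq' with rfl | hq'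
      · rcases hx with rfl | rfl
        · simp [hs q' (by simp)]
        · simp
      · have := ih' (show x ∈ visited q.dst W from Or.inr ⟨q', hq', hx⟩)
        simp only [Set.mem_ofPred_eq, List.map_cons] at this ⊢
        exact List.mem_cons_of_mem _ this

/-- Some `k` vertices of a walk of a positive instance, in an order in which the walk meets them:
labels that number them consecutively lead to acceptance. -/
theorem exists_list_of_isYes (h : I.IsYes) : ∃ Z : List ℕ, Z.length = I.k ∧ Z.Nodup ∧
    (∀ x ∈ Z, x < I.n) ∧ ∀ L : ℕ → ℕ, (∀ v, L v ≤ I.k) →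
      (∀ j (hj : j < Z.length), L Z[j] = j + 1) → I.Accepts L := by
  classical
  obtain ⟨W, hW, hft, hk, hcost⟩ := h
  have hhead : ∀ q ∈ W.head?, q.src = I.source := by
    intro q hq
    rcases hft with ⟨rfl, -⟩ | ⟨⟨q', hq', hs⟩, -⟩
    · simp at hq
    · rw [Option.mem_def, hq'] at hq
      cases hq
      exact hs
  have hlast : (W.map fun q => (q.dst : ℕ)).getLastD I.source = I.sink := by
    rcases hft with ⟨rfl, hs⟩ | ⟨-, q', hq', hs⟩
    · simp [hs]
    · rw [List.getLastD_eq_getLast?, List.getLast?_map, hq', ← hs]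
      rfl
  set vs := I.source :: W.map TimedMove.dst with hvs
  -- `dedup` keeps the last occurrence of each vertex; any order along the walk will do.
  have hlen : I.k ≤ vs.dedup.length := by
    refine hk.trans ?_
    rw [← List.card_toFinset, ← Set.ncard_coe_finset]
    refine Set.ncard_le_ncard (fun x hx => ?_) (Set.toFinite _)
    exact Finset.mem_coe.2 (List.mem_toFinset.2 (I.visited_subset W hW hhead hx))
  refine ⟨(vs.dedup.take I.k).map Fin.val, by simpa using hlen, ?_, ?_, ?_⟩
  · exact ((List.nodup_dedup vs).sublist (List.take_sublist _ _)).map Fin.val_injective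
  · intro x hx
    obtain ⟨y, -, rfl⟩ := List.mem_map.1 hx
    exact y.2
  · intro L hLk hL
    have hsub : ((vs.dedup.take I.k).map Fin.val).Sublist (vs.map Fin.val) :=
      ((List.take_sublist _ _).trans (List.dedup_sublist _)).map _
    have hle := le_foldl_advance (L := L) hsub 0 0 le_rfl (by simpa using hL)
    have hge := foldl_advance_le hLk (vs.map Fin.val) (Nat.zero_le _)
    have hprog : (vs.map Fin.val).foldl (advance L) 0 = I.k := by
      refine le_antisymm hge (le_trans ?_ hle)
      simp [hlen]
    obtain ⟨r, c, hc, hr⟩ := I.reach_of_walk W (Reach.start (F := I.table) (L := L)) hW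
      (fun q hq => ⟨congrArg Fin.val (hhead q hq), Nat.zero_le _⟩)
    refine ⟨r, c, ?_, by rw [hc] at hcost; exact_mod_cast hcost⟩
    rw [hlast, zero_add] at hr
    have heq : (W.map fun q => (q.dst : ℕ)).foldl (advance L) (advance L 0 I.source) = I.k := by
      rw [← hprog, hvs]
      simp [List.foldl_map]
    rwa [heq] at hr

end CCTOInstance

/-! ### The labellings that are tried -/

/-- The number `j + 1` for the last `j < i` such that digit `j` of `e` in base `m` is `d`, and `0`
if there is none. -/
def digitIndex (m e : ℕ) : ℕ → ℕ → ℕ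
  | 0, _ => 0
  | i + 1, d => if e / m ^ i % m = d then i + 1 else digitIndex m e i d

/-- The label of vertex `v`: its colour is `(a v mod p) mod (k² + 1)`, and the `k` digits of `e` list
the colours that are to get the labels `1, …, k`. -/
def label (k p a e v : ℕ) : ℕ := digitIndex (k * k + 1) e k (a * v % p % (k * k + 1))

theorem digitIndex_le (m e i d : ℕ) : digitIndex m e i d ≤ i := by
  induction i with
  | zero => exact le_rfl
  | succ i ih => unfold digitIndex; split <;> omega

theorem digitIndex_digit {m e i j : ℕ} (hj : j < i)
    (h : ∀ j' < i, e / m ^ j' % m = e / m ^ j % m → j' = j) :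
    digitIndex m e i (e / m ^ j % m) = j + 1 := by
  induction i with
  | zero => omega
  | succ i ih =>
    unfold digitIndex
    split
    · rename_i heq
      rw [h i (by omega) heq]
    · rename_i hne
      have : j ≠ i := by rintro rfl; exact hne rfl
      exact ih (by omega) fun j' hj' => h j' (by omega)

theorem exists_digits {m k : ℕ} (f : ℕ → ℕ) (hf : ∀ j < k, f j < m) :
    ∃ e < m ^ k, ∀ j < k, e / m ^ j % m = f j := by
  let g : Fin k → Fin m := fun j => ⟨f j, hf j j.2⟩
  refine ⟨finFunctionFinEquiv g, (finFunctionFinEquiv g).2, fun j hj => ?_⟩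
  have := congrFun (finFunctionFinEquiv.symm_apply_apply g) ⟨j, hj⟩
  exact congrArg Fin.val this

/-- A positive instance is recognised by one of the labellings: a prime modulus between `n` and `2n`
and a suitable multiplier separate the chosen vertices. -/
theorem CCTOInstance.isYes_iff (I : CCTOInstance) : I.IsYes ↔
    ∃ j < I.n + 1, ∃ a < I.n + j, ∃ e < (I.k * I.k + 1) ^ I.k,
      I.Accepts (label I.k (I.n + j) a e) := by
  refine ⟨fun h => ?_, fun ⟨_, _, _, _, _, _, h⟩ => I.isYes_of_accepts h⟩
  obtain ⟨Z, hlen, hnd, hZ, hacc⟩ := I.exists_list_of_isYes h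
  have hn : I.n ≠ 0 := by have := I.source.2; omega
  obtain ⟨p, hp, hnp, hp2⟩ := Nat.exists_prime_lt_and_le_two_mul I.n hn
  obtain ⟨a, ha, hinj⟩ := exists_injOn_mul_mod_mod (k := I.k) hp Z.toFinset
    (fun x hx => (hZ x (by simpa using hx)).trans hnp)
    (by rw [List.toFinset_card_of_nodup hnd, hlen])
  obtain ⟨e, he, hdig⟩ := exists_digits (m := I.k * I.k + 1) (k := I.k)
    (fun j => a * Z.getD j 0 % p % (I.k * I.k + 1)) (fun j _ => Nat.mod_lt _ (by omega))
  refine ⟨p - I.n, by omega, a, by omega, e, he, ?_⟩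
  rw [show I.n + (p - I.n) = p by omega]
  refine hacc _ (fun v => digitIndex_le _ _ _ _) fun j hj => ?_
  have hj' : j < I.k := by omega
  have hd := hdig j hj'
  rw [List.getD_eq_getElem _ _ hj] at hd
  rw [label, ← hd]
  refine digitIndex_digit hj' fun j' hj'' heq => ?_
  rw [hdig j' hj'', hdig j hj', List.getD_eq_getElem _ _ hj,
    List.getD_eq_getElem _ _ (by omega : j' < Z.length)] at heq
  exact (List.Nodup.getElem_inj_iff hnd).1 (hinj (by simp) (by simp) heq)

/-! ### The table of remaining budgets -/

namespace CCTOInstance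

variable (I : CCTOInstance) (L : ℕ → ℕ)

/-- The number of pairs of a vertex and a time step; the pair `(v, t)` has the number
`v * I.T + t`. -/
def nodes : ℕ := I.n * I.T

/-- A nonzero entry `b + 1` for progress `i` and node `x` is justified by a walk that leaves `b` of
the budget. The entry is found at address `i * I.nodes + x`. -/
def BudgetSound (D : ℕ → ℕ) : Prop :=
  ∀ i ≤ I.k, ∀ x < I.nodes, ∀ b, D (i * I.nodes + x) = b + 1 →
    ∃ r c, Reach I.table L I.source r i (x / I.T) (x % I.T) c ∧ c + b = I.budget

/-- The entries take all walks with at most `r` moves into account. -/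
def BudgetComplete (r : ℕ) (D : ℕ → ℕ) : Prop :=
  ∀ r' ≤ r, ∀ i ≤ I.k, ∀ v t c, Reach I.table L I.source r' i v t c →
    I.budget + 1 ≤ D (i * I.nodes + (v * I.T + t)) + c

/-- The cost of the move from node `x` to node `y`, as a machine word. -/
def word (x y : ℕ) : ℕ := I.table (x / I.T) (y / I.T) (x % I.T) (y % I.T)

/-- The address of the entry that is affected by a move to node `y` with progress `i`. -/
def target (i y : ℕ) : ℕ := advance L i (y / I.T) * I.nodes + y

/-- The table after trying the move from node `x` to node `y` with progress `i`. The remaining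
budget plus one of the extended walk is a truncated difference, and `0` exactly if the budget is
exceeded. -/
def relax (i x y : ℕ) (D : ℕ → ℕ) : ℕ → ℕ :=
  if I.word x y = 0 then D
  else Function.update D (I.target L i y)
    (max (D (I.target L i y)) (D (i * I.nodes + x) + 1 - I.word x y))

/-- `D'` arises from `D` by sound increases which include trying the moves in `S`, a set of triples of
a progress and two nodes. -/
structure Improves (D D' : ℕ → ℕ) (S : ℕ → ℕ → ℕ → Prop) : Prop where
  sound : I.BudgetSound L D → I.BudgetSound L D'
  mono : ∀ z, D z ≤ D' z
  relaxed : ∀ i x y, S i x y → I.word x y ≠ 0 →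
    D (i * I.nodes + x) + 1 ≤ D' (I.target L i y) + I.word x y

variable {I L}

theorem Improves.refl (D : ℕ → ℕ) : I.Improves L D D fun _ _ _ => False :=
  ⟨id, fun _ => le_rfl, fun _ _ _ h => h.elim⟩

theorem Improves.trans {D D' D'' : ℕ → ℕ} {S S' U : ℕ → ℕ → ℕ → Prop} (h : I.Improves L D D' S)
    (h' : I.Improves L D' D'' S') (hU : ∀ i x y, U i x y → S i x y ∨ S' i x y) :
    I.Improves L D D'' U := by
  refine ⟨h'.sound ∘ h.sound, fun z => (h.mono z).trans (h'.mono z), fun i x y hs hw => ?_⟩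
  rcases hU i x y hs with hs | hs
  · have := h.relaxed i x y hs hw
    have := h'.mono (I.target L i y)
    omega
  · have := h'.relaxed i x y hs hw
    have := h.mono (i * I.nodes + x)
    omega

theorem Improves.subset {D D' : ℕ → ℕ} {S U : ℕ → ℕ → ℕ → Prop} (h : I.Improves L D D' S)
    (hU : ∀ i x y, U i x y → S i x y) : I.Improves L D D' U :=
  ⟨h.sound, h.mono, fun i x y hs => h.relaxed i x y (hU i x y hs)⟩

theorem address_inj {N i i' x x' : ℕ} (hx : x < N) (hx' : x' < N)
    (h : i * N + x = i' * N + x') : i = i' ∧ x = x' := by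
  have hN : 0 < N := by omega
  have h1 := congrArg (· / N) h
  have h2 := congrArg (· % N) h
  simp only [Nat.mul_comm _ N, Nat.mul_add_mod, Nat.mod_eq_of_lt hx, Nat.mod_eq_of_lt hx'] at h2
  simp only [Nat.mul_comm _ N, Nat.mul_add_div hN, Nat.div_eq_of_lt hx, Nat.div_eq_of_lt hx'] at h1
  exact ⟨by omega, h2⟩

theorem improves_relax {i x y : ℕ} (hi : i ≤ I.k) (hx : x < I.nodes) (hy : y < I.nodes)
    (D : ℕ → ℕ) :
    I.Improves L D (I.relax L i x y D) fun i' x' y' => i' = i ∧ x' = x ∧ y' = y := by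
  unfold relax
  split
  · rename_i hw
    refine ⟨id, fun _ => le_rfl, ?_⟩
    rintro _ _ _ ⟨rfl, rfl, rfl⟩ h
    exact absurd hw h
  · rename_i hw
    refine ⟨fun hD i' hi' x' hx' b hb => ?_, fun z => ?_, ?_⟩
    · by_cases haddr : i' * I.nodes + x' = I.target L i y
      · obtain ⟨rfl, rfl⟩ := address_inj hx' hy haddr
        rw [haddr, Function.update_self] at hb
        -- The maximum is attained either by the old entry or by the extended walk.
        by_cases hcur : D (I.target L i x') = b + 1
        · exact hD _ hi' _ hx' b (by rw [haddr, hcur])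
        · obtain ⟨w, hw'⟩ := Nat.exists_eq_succ_of_ne_zero hw
          have hold : D (i * I.nodes + x) = b + w + 1 := by
            rw [hw'] at hb
            omega
          obtain ⟨r, c, hr, hc⟩ := hD i hi x hx _ hold
          exact ⟨r + 1, c + w, hr.step hw', by omega⟩
      · rw [Function.update_of_ne haddr] at hb
        exact hD i' hi' x' hx' b hb
    · by_cases hz : z = I.target L i y
      · subst hz
        rw [Function.update_self]
        exact le_max_left _ _
      · rw [Function.update_of_ne hz]
    · rintro _ _ _ ⟨rfl, rfl, rfl⟩ _
      rw [Function.update_self]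
      omega

theorem node_lt {v t : ℕ} (hv : v < I.n) (ht : t < I.T) : v * I.T + t < I.nodes := by
  have : (v + 1) * I.T ≤ I.n * I.T := Nat.mul_le_mul_right _ hv
  rw [Nat.succ_mul] at this
  unfold nodes
  omega

theorem node_div (v : ℕ) {t : ℕ} (ht : t < I.T) : (v * I.T + t) / I.T = v := by
  rw [Nat.mul_comm, Nat.mul_add_div I.T_pos, Nat.div_eq_of_lt ht, Nat.add_zero]

theorem node_mod (v : ℕ) {t : ℕ} (ht : t < I.T) : (v * I.T + t) % I.T = t := by
  rw [Nat.mul_comm, Nat.mul_add_mod, Nat.mod_eq_of_lt ht]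

/-- One round of trying all moves takes walks with one more move into account. -/
theorem BudgetComplete.succ {D D' : ℕ → ℕ} {r : ℕ} (h : I.BudgetComplete L r D)
    (hD : I.Improves L D D' fun i x y => i ≤ I.k ∧ x < I.nodes ∧ y < I.nodes) :
    I.BudgetComplete L (r + 1) D' := by
  intro r' hr' i hi v t c hreach
  cases hreach with
  | start =>
    have := h 0 (Nat.zero_le _) _ hi _ _ _ .start
    have := hD.mono (advance L 0 I.source * I.nodes + (I.source * I.T + 0))
    omega
  | @step r₀ i₀ u t₀ c₀ _ _ w h₀ hw =>
    obtain ⟨hu, hv, ht₀, ht, -, -⟩ := I.table_eq_succ hw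
    have hi₀ : i₀ ≤ I.k := (le_advance L i₀ v).trans hi
    have h1 := h r₀ (by omega) i₀ hi₀ _ _ _ h₀
    have hword : I.word (u * I.T + t₀) (v * I.T + t) = w + 1 := by
      rw [word, node_div _ ht₀, node_div _ ht, node_mod _ ht₀, node_mod _ ht, hw]
    have h2 := hD.relaxed i₀ (u * I.T + t₀) (v * I.T + t) ⟨hi₀, node_lt hu ht₀, node_lt hv ht⟩
      (by omega)
    rw [hword, target, node_div _ ht] at h2
    omega

theorem budgetSound_start {D : ℕ → ℕ} (hD : ∀ i ≤ I.k, ∀ x < I.nodes, D (i * I.nodes + x) = 0) :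
    I.BudgetSound L (Function.update D (I.target L 0 (I.source * I.T)) (I.budget + 1)) := by
  intro i hi x hx b hb
  by_cases haddr : i * I.nodes + x = I.target L 0 (I.source * I.T)
  · rw [haddr, Function.update_self] at hb
    have := node_div (I := I) I.source I.T_pos
    have hmod := node_mod (I := I) I.source I.T_pos
    rw [add_zero] at this hmod
    obtain ⟨rfl, rfl⟩ := address_inj hx (by simpa using node_lt (I := I) I.source.2 I.T_pos) haddr
    rw [this, hmod]
    exact ⟨0, 0, .start, by omega⟩
  · rw [Function.update_of_ne haddr, hD i hi x hx] at hb
    omega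

theorem budgetComplete_start (D : ℕ → ℕ) : I.BudgetComplete L 0
    (Function.update D (I.target L 0 (I.source * I.T)) (I.budget + 1)) := by
  intro r' hr' i hi v t c hreach
  cases hreach with
  | start =>
    have := node_div (I := I) I.source I.T_pos
    rw [add_zero] at this
    rw [target, this, add_zero (_ * _), Function.update_self]
  | step => omega

/-- After `T` rounds, the entry for the sink at the last time step answers the question, since every
move takes time. -/
theorem accepts_iff {D : ℕ → ℕ} (hs : I.BudgetSound L D) (hc : I.BudgetComplete L I.T D) :
    I.Accepts L ↔ D (I.k * I.nodes + (I.sink * I.T + (I.T - 1))) ≠ 0 := by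
  have hT : I.T - 1 < I.T := by have := I.T_pos; omega
  constructor
  · rintro ⟨r, c, h, hcb⟩
    obtain ⟨-, -, -, hr, -⟩ := I.exists_walk_of_reach h
    have := hc r (by omega) _ le_rfl _ _ _ h
    omega
  · intro h
    obtain ⟨b, hb⟩ := Nat.exists_eq_succ_of_ne_zero h
    obtain ⟨r, c, hr, hcb⟩ := hs _ le_rfl _ (node_lt I.sink.2 hT) b hb
    rw [node_div _ hT, node_mod _ hT] at hr
    exact ⟨r, c, hr, by omega⟩

end CCTOInstance

/-! ### The program -/

namespace RAM

/-- The number `n` of vertices. -/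
notation "r_n" => (0 : ℕ)
/-- The lifetime `T`. -/
notation "r_T" => (1 : ℕ)
/-- The target number `k` of vertices. -/
notation "r_k" => (2 : ℕ)
/-- The budget. -/
notation "r_budget" => (3 : ℕ)
/-- The source. -/
notation "r_source" => (4 : ℕ)
/-- The sink. -/
notation "r_sink" => (5 : ℕ)
/-- The number `k² + 1` of colours. -/
notation "r_colours" => (8 : ℕ)
/-- The number `(k² + 1) ^ k` of colour sequences. -/
notation "r_codes" => (9 : ℕ)
/-- The number `n * T` of nodes. -/
notation "r_nodes" => (10 : ℕ)
/-- The node of the source at the first time step. -/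
notation "r_start" => (11 : ℕ)
/-- The address of the entry that answers the question. -/
notation "r_goal" => (12 : ℕ)
/-- `n + 1`. -/
notation "r_nsucc" => (13 : ℕ)
/-- `k + 1`. -/
notation "r_ksucc" => (14 : ℕ)
/-- The length of the tables of quotients and remainders modulo `k² + 1`. -/
notation "r_len" => (15 : ℕ)
/-- The number `(k + 1) * (n * T)` of entries of the table of remaining budgets. -/
notation "r_size" => (16 : ℕ)
/-- A number that is nonzero as soon as some labelling has led to acceptance. -/
notation "r_answer" => (17 : ℕ)
/-- The modulus of the hash function. -/
notation "r_p" => (18 : ℕ)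
/-- The address of the layer of the current progress in the table of remaining budgets. -/
notation "r_layer" => (23 : ℕ)
/-- The address of the next layer. -/
notation "r_next" => (24 : ℕ)
/-- The current progress plus one. -/
notation "r_label" => (25 : ℕ)
/-- The multiplier of the hash function. -/
notation "r_a" => (32 : ℕ)
/-- The code of the sequence of colours. -/
notation "r_e" => (34 : ℕ)

/-- Quotients modulo `k² + 1`. -/
notation "a_div" => (0 : ℕ)
/-- Remainders modulo `k² + 1`. -/
notation "a_mod" => (1 : ℕ)
/-- The vertices of the nodes. -/
notation "a_vertex" => (2 : ℕ)
/-- The time steps of the nodes. -/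
notation "a_time" => (3 : ℕ)
/-- The labels of the colours. -/
notation "a_index" => (4 : ℕ)
/-- The labels of the vertices. -/
notation "a_label" => (5 : ℕ)
/-- The table of remaining budgets. -/
notation "a_budget" => (6 : ℕ)

/-- Store the product of the registers `x` and `b` in register `d`, by repeated addition. -/
def mulProgram (d x b : ℕ) : Program :=
  .seq (block [.const d 0]) (forLoop 56 57 b (block [.add d d x]))

/-- Fill the arrays `q` and `r` with the quotients and remainders of the indices modulo the content of
register `m`, for all indices below the content of register `len`. -/
def divModProgram (q r m len : ℕ) : Program :=
  .seq (block [.const 20 0, .const 21 0])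
    (forLoop 56 57 len (.seq
      (block [.store q 56 20, .store r 56 21, .add 21 21 r_one, .sub 22 m 21])
      (.ifNonzero 22 .skip (block [.const 21 0, .add 20 20 r_one]))))

/-- Clear the entries of the array `a` with an index below the content of register `b`. -/
def clearProgram (a b : ℕ) : Program := forLoop 36 37 b (block [.store a 36 r_zero])

/-- Compute the labels of the colours from the digits of the code; if a colour occurs repeatedly, its
last occurrence counts. -/
def indexProgram : Program :=
  .seq (clearProgram a_index r_colours) (.seq (block [.add 20 r_e r_zero])
    (forLoop 38 39 r_k (block [.add 21 38 r_one, .load 22 a_mod 20, .store a_index 22 21,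
      .load 20 a_div 20])))

/-- Compute the labels of the vertices; register `20` runs through the multiples of the
multiplier modulo `r_p`. -/
def labelProgram : Program :=
  .seq indexProgram (.seq (block [.const 20 0])
    (forLoop 40 41 r_n (.seq
      (block [.load 21 a_mod 20, .load 21 a_index 21, .store a_label 40 21, .add 20 20 r_a,
        .sub 21 r_p 20])
      (.ifNonzero 21 .skip (block [.sub 20 20 r_p])))))

/-- Initialise the table of remaining budgets: the whole budget is left at the source, with progress
`1` if the source has label `1`. The sum `(l - 1) + (1 - l)` of truncated differences is nonzero
exactly if `l ≠ 1`. -/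
def startProgram : Program :=
  .seq (clearProgram a_budget r_size) (.seq
    (block [.load 20 a_label r_source, .sub 21 20 r_one, .sub 22 r_one 20, .add 21 21 22])
    (.seq (.ifNonzero 21 (block [.add 22 r_start r_zero]) (block [.add 22 r_start r_nodes]))
      (block [.add 21 r_budget r_one, .store a_budget 22 21])))

/-- Try the move from the node in register `50` to the node in register `52`. Moves that do not go
forward in time need no separate test, as the input table holds `0` for them. The entry at the target
becomes the maximum of its old value and the new one, computed as `cur + (new - cur)`. -/
def relaxProgram : Program :=
  .seq (block [.load 20 a_vertex 50, .load 21 a_time 50, .load 22 a_vertex 52, .load 26 a_time 52,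
      .lookup 27 20 22 21 26])
    (.ifNonzero 27
      (.seq (block [.load 28 a_label 22, .sub 29 28 r_label, .sub 20 r_label 28, .add 29 29 20])
        (.seq (.ifNonzero 29 (block [.add 20 r_layer 52]) (block [.add 20 r_next 52]))
          (block [.add 21 r_layer 50, .load 21 a_budget 21, .add 21 21 r_one, .sub 21 21 27,
            .load 22 a_budget 20, .sub 21 21 22, .add 22 22 21, .store a_budget 20 22])))
      .skip)

/-- Try all moves with the current progress. -/
def layerProgram : Program := forLoop 50 51 r_nodes (forLoop 52 53 r_nodes relaxProgram)

/-- Try all moves with all progresses. -/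
def roundProgram : Program :=
  .seq (block [.const r_layer 0])
    (forLoop 48 49 r_ksucc (.seq (block [.add r_label 48 r_one, .add r_next r_layer r_nodes])
      (.seq layerProgram (block [.add r_layer r_next r_zero]))))

/-- Find out whether the current labelling leads to acceptance. -/
def guessProgram : Program :=
  .seq labelProgram (.seq startProgram (.seq (forLoop 46 47 r_T roundProgram)
    (block [.load 20 a_budget r_goal, .add r_answer r_answer 20])))

/-- Try all labellings. -/
def searchProgram : Program :=
  forLoop 30 31 r_nsucc (.seq (block [.add r_p r_n 30])
    (forLoop r_a 33 r_p (forLoop r_e 35 r_codes guessProgram)))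

/-- Compute the numbers that do not depend on the labelling. -/
def numbersProgram : Program :=
  .seq (block [.const r_one 1, .const r_zero 0, .const r_answer 0]) <|
  .seq (mulProgram r_colours r_k r_k) <|
  .seq (block [.add r_colours r_colours r_one, .const r_codes 1]) <|
  .seq (forLoop 54 55 r_k (.seq (mulProgram 20 r_codes r_colours) (block [.add r_codes 20 r_zero]))) <|
  .seq (mulProgram r_nodes r_T r_n) <|
  .seq (mulProgram r_start r_source r_T) <|
  .seq (mulProgram 20 r_nodes r_k) <|
  .seq (mulProgram 21 r_sink r_T)
    (block [.sub 22 r_T r_one, .add 21 21 22, .add r_goal 20 21, .add r_nsucc r_n r_one,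
      .add r_ksucc r_k r_one, .add r_len r_n r_nsucc, .add r_len r_len r_codes, .add r_size 20 r_nodes])

/-- The program that solves CCTO. -/
def cctoProgram : Program :=
  .seq numbersProgram <|
  .seq (divModProgram a_div a_mod r_colours r_len) <|
  .seq (divModProgram a_vertex a_time r_T r_nodes) <|
  .seq searchProgram (.ifNonzero r_answer (block [.const 0 1]) (block [.const 0 0]))

/-! ### Products, tables and clearing -/

variable {F : ℕ → ℕ → ℕ → ℕ → ℕ}

theorem Spec.block_eq {l : List Instr} {σ : State} : Spec F (RAM.block l) σ l.length
    fun τ => τ = l.foldl (fun σ c => c.exec F σ) σ := Spec.block rfl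

theorem spec_mulProgram {d x b : ℕ} {σ : State} (h1 : σ.reg r_one = 1) (h0 : σ.reg r_zero = 0)
    (hd : d ∉ [x, b, r_one, r_zero, 56, 57]) (hx : x ∉ [56, 57]) :
    Spec F (mulProgram d x b) σ (4 * σ.reg b + 4) fun τ => τ.reg d = σ.reg x * σ.reg b := by
  simp only [List.mem_cons, List.not_mem_nil, or_false, not_or] at hd hx
  obtain ⟨hdx, hdb, hd1, hd0, hd56, hd57⟩ := hd
  refine (Spec.seq Spec.block_eq fun τ _ hτ => ?_).weaken (c := 1 + (σ.reg b * (1 + 3) + 3))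
    (by omega) fun _ _ h => h
  subst hτ
  refine Spec.forLoop (fun j τ => τ.reg d = σ.reg x * j) ?_ ?_ ?_ ?_ ?_ ?_ ?_
  · simp [Instr.exec, State.setReg, Ne.symm hdb]
  · simp [Instr.exec, State.setReg, Ne.symm hd1, h1]
  · simp [Instr.exec, State.setReg, Ne.symm hd0, h0]
  · simp [block, Program.modReg, Instr.modReg, Ne.symm hd56, Ne.symm hd57, Ne.symm hd1]
  · intro j τ τ' h hoff
    rw [hoff.1 d hd56 hd57, h]
  · simp [Instr.exec, State.setReg]
  · intro j _ τ _ hfr hinv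
    have hτx := hfr.1 x (by
      simp [forLoop, block, Program.modReg, Instr.modReg, Ne.symm hdx, hx])
    refine Spec.block ?_
    simp only [List.foldl_cons, List.foldl_nil, Instr.exec, State.setReg, Function.update_self]
      at hτx ⊢
    rw [hinv, hτx, Function.update_of_ne (Ne.symm hdx)]
    ring

theorem spec_divModProgram {q r m len : ℕ} {σ : State} (h1 : σ.reg r_one = 1)
    (h0 : σ.reg r_zero = 0) (hqr : q ≠ r) (hm : m ∉ [20, 21, 22, 56, 57]) (hm0 : 0 < σ.reg m)
    (hlen : len ∉ [20, 21]) :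
    Spec F (divModProgram q r m len) σ (10 * σ.reg len + 5) fun τ =>
      ∀ z < σ.reg len, τ.arr q z = z / σ.reg m ∧ τ.arr r z = z % σ.reg m := by
  simp only [List.mem_cons, List.not_mem_nil, or_false, not_or] at hm hlen
  obtain ⟨hm20, hm21, hm22, hm56, hm57⟩ := hm
  refine Spec.weaken (c := 2 + (σ.reg len * (7 + 3) + 3)) (B := fun τ =>
    τ.reg 20 = σ.reg len / σ.reg m ∧ τ.reg 21 = σ.reg len % σ.reg m ∧
      ∀ z < σ.reg len, τ.arr q z = z / σ.reg m ∧ τ.arr r z = z % σ.reg m)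
    (Spec.seq Spec.block_eq fun τ _ hτ => ?_) (by omega) fun _ _ h => h.2.2
  subst hτ
  refine Spec.forLoop (fun j τ => τ.reg 20 = j / σ.reg m ∧ τ.reg 21 = j % σ.reg m ∧
    ∀ z < j, τ.arr q z = z / σ.reg m ∧ τ.arr r z = z % σ.reg m) ?_ ?_ ?_ ?_ ?_ ?_ ?_
  · simp [Instr.exec, State.setReg, hlen]
  · simp [Instr.exec, State.setReg, h1]
  · simp [Instr.exec, State.setReg, h0]
  · simp [block, Program.modReg, Instr.modReg]
  · rintro j τ τ' ⟨h20, h21, h⟩ hoff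
    rw [hoff.1 20 (by decide) (by decide), hoff.1 21 (by decide) (by decide), hoff.2]
    exact ⟨h20, h21, h⟩
  · simp [Instr.exec, State.setReg]
  · rintro j - τ hj hfr ⟨h20, h21, hz⟩
    have hτm : τ.reg m = σ.reg m := by
      rw [hfr.1 m (by simp [forLoop, block, Program.modReg, Instr.modReg, *])]
      simp [Instr.exec, State.setReg, hm20, hm21]
    have hτ1 : τ.reg r_one = 1 := by
      rw [hfr.1 r_one (by simp [forLoop, block, Program.modReg, Instr.modReg])]
      simp [Instr.exec, State.setReg, h1]
    have hdm := Nat.div_add_mod j (σ.reg m)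
    have hlt := Nat.mod_lt j hm0
    refine Spec.seq (c := 4) (c' := 2 + 1) (B := fun υ => υ.reg 20 = j / σ.reg m ∧
      υ.reg 21 = j % σ.reg m + 1 ∧ υ.reg 22 = σ.reg m - (j % σ.reg m + 1) ∧ υ.reg r_one = 1 ∧
      ∀ z < j + 1, υ.arr q z = z / σ.reg m ∧ υ.arr r z = z % σ.reg m) (Spec.block ?_) ?_
    · simp only [List.foldl_cons, List.foldl_nil, Instr.exec, State.setReg, State.setArr]
      refine ⟨by simp [h20], by simp [h21, hτ1], by simp [hm21, hτm, h21, hτ1],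
        by simp [hτ1], fun z hzj => ?_⟩
      simp only [Function.update_of_ne hqr, Function.update_self, hj, h20, h21]
      by_cases hzj' : z = j
      · subst hzj'
        simp
      · simpa [hzj', hqr.symm] using hz z (by omega)
    · rintro υ - ⟨hu20, hu21, hu22, hu1, hu⟩
      refine Spec.ifNonzero (fun hne => ⟨0, υ, .skip υ, by omega, ?_⟩) fun he => Spec.block ?_
      · have := (Nat.div_mod_unique (a := j + 1) (d := j / σ.reg m) (c := j % σ.reg m + 1) hm0).2
          ⟨by omega, by omega⟩
        exact ⟨by rw [hu20, this.1], by rw [hu21, this.2], hu⟩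
      · have := (Nat.div_mod_unique (a := j + 1) (d := j / σ.reg m + 1) (c := 0) hm0).2
          ⟨by rw [Nat.mul_add]; omega, hm0⟩
        simp only [List.foldl_cons, List.foldl_nil, Instr.exec, State.setReg]
        refine ⟨by simp [hu20, hu1, this.1], by simp [this.2], hu⟩

theorem spec_clearProgram {a b : ℕ} {σ : State} (h1 : σ.reg r_one = 1) (h0 : σ.reg r_zero = 0) :
    Spec F (clearProgram a b) σ (4 * σ.reg b + 3) fun τ => ∀ z < σ.reg b, τ.arr a z = 0 := by
  refine (Spec.forLoop (K := 1) (fun j τ => ∀ z < j, τ.arr a z = 0) rfl h1 h0 ?_ ?_ ?_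
    ?_).weaken (by omega) fun _ _ h => h
  · simp [block, Program.modReg, Instr.modReg]
  · intro j τ τ' h hoff
    rwa [hoff.2]
  · simp
  · intro j _ τ hj hfr hinv
    have hτ0 : τ.reg r_zero = 0 := by
      rw [hfr.1 r_zero (by simp [forLoop, block, Program.modReg, Instr.modReg]), h0]
    refine Spec.block ?_
    simp only [List.foldl_cons, List.foldl_nil, Instr.exec, State.setArr, Function.update_self, hj,
      hτ0]
    intro z hz
    by_cases hzj : z = j
    · simp [hzj]
    · simpa [hzj] using hinv z (by omega)

variable {I : CCTOInstance}

/-! ### One labelling and one move -/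

/-- The registers that do not depend on the labelling have been computed. -/
structure Numbers (I : CCTOInstance) (σ : State) : Prop where
  n : σ.reg r_n = I.n
  T : σ.reg r_T = I.T
  k : σ.reg r_k = I.k
  budget : σ.reg r_budget = I.budget
  source : σ.reg r_source = I.source
  one : σ.reg r_one = 1
  zero : σ.reg r_zero = 0
  colours : σ.reg r_colours = I.k * I.k + 1
  codes : σ.reg r_codes = (I.k * I.k + 1) ^ I.k
  nodes : σ.reg r_nodes = I.nodes
  start : σ.reg r_start = I.source * I.T
  goal : σ.reg r_goal = I.k * I.nodes + (I.sink * I.T + (I.T - 1))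
  nsucc : σ.reg r_nsucc = I.n + 1
  ksucc : σ.reg r_ksucc = I.k + 1
  len : σ.reg r_len = (I.k * I.k + 1) ^ I.k + (2 * I.n + 1)
  size : σ.reg r_size = (I.k + 1) * I.nodes

/-- The registers and also the tables that do not depend on the labelling have been computed. -/
structure Ready (I : CCTOInstance) (σ : State) : Prop extends Numbers I σ where
  divMod : ∀ z < (I.k * I.k + 1) ^ I.k + (2 * I.n + 1),
    σ.arr a_div z = z / (I.k * I.k + 1) ∧ σ.arr a_mod z = z % (I.k * I.k + 1)
  vertexTime : ∀ z < I.nodes, σ.arr a_vertex z = z / I.T ∧ σ.arr a_time z = z % I.T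

theorem Numbers.frame {P : Program} {σ τ : State} (h : Numbers I σ) (hf : P.Frame σ τ)
    (hP : ∀ r < 17, P.modReg r = false) : Numbers I τ := by
  have hr : ∀ r < 17, τ.reg r = σ.reg r := fun r hr => hf.1 r (hP r hr)
  constructor
  all_goals rw [hr _ (by decide)]
  exacts [h.n, h.T, h.k, h.budget, h.source, h.one, h.zero, h.colours, h.codes, h.nodes, h.start,
    h.goal, h.nsucc, h.ksucc, h.len, h.size]

/-- A program that assigns none of the registers and arrays described by `Ready`. -/
def Program.Keeps (P : Program) : Prop :=
  (∀ r < 17, P.modReg r = false) ∧ ∀ a < 4, P.modArr a = false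

theorem Ready.frame {P : Program} {σ τ : State} (h : Ready I σ) (hf : P.Frame σ τ)
    (hP : P.Keeps) : Ready I τ := by
  have ha : ∀ a < 4, τ.arr a = σ.arr a := fun a ha => hf.2 a (hP.2 a ha)
  refine ⟨h.toNumbers.frame hf hP.1, ?_, ?_⟩ <;> rw [ha _ (by decide), ha _ (by decide)]
  exacts [h.divMod, h.vertexTime]

theorem keeps_indexProgram : indexProgram.Keeps := by unfold Program.Keeps; decide
theorem keeps_labelProgram : labelProgram.Keeps := by unfold Program.Keeps; decide
theorem keeps_startProgram : startProgram.Keeps := by unfold Program.Keeps; decide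
theorem keeps_layerProgram : layerProgram.Keeps := by unfold Program.Keeps; decide
theorem keeps_searchProgram : searchProgram.Keeps := by unfold Program.Keeps; decide

theorem spec_indexProgram {σ : State} (h : Ready I σ)
    (he : σ.reg r_e < (I.k * I.k + 1) ^ I.k) :
    Spec I.table indexProgram σ (4 * (I.k * I.k + 1) + 7 * I.k + 7) fun τ =>
      ∀ d < I.k * I.k + 1, τ.arr a_index d = digitIndex (I.k * I.k + 1) (σ.reg r_e) I.k d := by
  set m := I.k * I.k + 1 with hm
  have hclear := spec_clearProgram (F := I.table) (a := a_index) (b := r_colours) h.one h.zero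
  refine Spec.weaken (c := (4 * m + 3) + (1 + (I.k * (4 + 3) + 3)))
    (B := fun τ => τ.reg 20 = σ.reg r_e / m ^ I.k ∧
      ∀ d < m, τ.arr a_index d = digitIndex m (σ.reg r_e) I.k d)
    (Spec.seq (B := fun τ => ∀ d < m, τ.arr a_index d = 0)
      (hclear.weaken (by rw [h.colours]) fun τ _ hτ => by rwa [h.colours] at hτ)
      fun τ hf hτ => Spec.seq Spec.block_eq fun υ hf' hυ => ?_)
    (by omega) fun _ _ h => h.2
  have h' := h.frame hf (by unfold Program.Keeps; decide)
  have hre : τ.reg r_e = σ.reg r_e := hf.1 _ (by decide)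
  have hu : Ready I υ := h'.frame hf' (by unfold Program.Keeps; decide)
  refine Spec.forLoop (fun j υ => υ.reg 20 = σ.reg r_e / m ^ j ∧
      ∀ d < m, υ.arr a_index d = digitIndex m (σ.reg r_e) j d) hu.k hu.one hu.zero
      (by decide) ?_ ?_ ?_
  · rintro j ω ω' ⟨h1, h2⟩ hoff
    rw [hoff.1 20 (by decide) (by decide), hoff.2]
    exact ⟨h1, h2⟩
  · subst hυ
    refine ⟨?_, hτ⟩
    simp [Instr.exec, State.setReg, hre, h'.zero]
  · rintro j hj ω hωj hf'' ⟨h20, hind⟩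
    have hw := hu.frame hf'' (by unfold Program.Keeps; decide)
    have hlt : σ.reg r_e / m ^ j < m ^ I.k + (2 * I.n + 1) := by
      have := Nat.div_le_self (σ.reg r_e) (m ^ j)
      omega
    obtain ⟨hdiv, hmod⟩ := hw.divMod _ hlt
    refine Spec.block ?_
    simp only [List.foldl_cons, List.foldl_nil, Instr.exec, State.setReg, State.setArr]
    refine ⟨?_, fun d hd => ?_⟩
    · simp [h20, hdiv, pow_succ, Nat.div_div_eq_div_mul, ← hm]
    · by_cases hdd : σ.reg r_e / m ^ j % m = d
      · simp [digitIndex, h20, hmod, ← hm, hdd, hωj, hw.one]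
      · simpa [digitIndex, h20, hmod, ← hm, hdd, Ne.symm hdd] using hind d hd

theorem spec_labelProgram {σ : State} (h : Ready I σ) (he : σ.reg r_e < (I.k * I.k + 1) ^ I.k)
    (hp : σ.reg r_p ≤ 2 * I.n) (ha : σ.reg r_a < σ.reg r_p) :
    Spec I.table labelProgram σ (4 * (I.k * I.k + 1) + 7 * I.k + 10 * I.n + 11) fun τ =>
      ∀ v < I.n, τ.arr a_label v = label I.k (σ.reg r_p) (σ.reg r_a) (σ.reg r_e) v := by
  set m := I.k * I.k + 1 with hm
  refine Spec.weaken (c := (4 * m + 7 * I.k + 7) + (1 + (I.n * (7 + 3) + 3)))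
    (B := fun τ => τ.reg 20 = σ.reg r_a * I.n % σ.reg r_p ∧
      ∀ v < I.n, τ.arr a_label v = label I.k (σ.reg r_p) (σ.reg r_a) (σ.reg r_e) v)
    (Spec.seq (spec_indexProgram h he)
      fun τ hf hτ => Spec.seq Spec.block_eq fun υ hf' hυ => ?_)
    (by omega) fun _ _ h => h.2
  have h' := h.frame hf keeps_indexProgram
  have hu : Ready I υ := h'.frame hf' (by unfold Program.Keeps; decide)
  have hup : υ.reg r_p = σ.reg r_p := (hf'.1 _ (by decide)).trans (hf.1 _ (by decide))
  have hua : υ.reg r_a = σ.reg r_a := (hf'.1 _ (by decide)).trans (hf.1 _ (by decide))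
  have hui : υ.arr a_index = τ.arr a_index := hf'.2 _ (by decide)
  refine Spec.forLoop (fun j υ => υ.reg 20 = σ.reg r_a * j % σ.reg r_p ∧
      ∀ v < j, υ.arr a_label v = label I.k (σ.reg r_p) (σ.reg r_a) (σ.reg r_e) v)
      hu.n hu.one hu.zero (by decide) ?_ ?_ ?_
  · rintro j ω ω' ⟨h1, h2⟩ hoff
    rw [hoff.1 20 (by decide) (by decide), hoff.2]
    exact ⟨h1, h2⟩
  · subst hυ
    simp [Instr.exec, State.setReg]
  · rintro j hj ω hωj hf'' ⟨h20, hlab⟩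
    have hw := hu.frame hf'' (by unfold Program.Keeps; decide)
    have hwp : ω.reg r_p = σ.reg r_p := (hf''.1 _ (by decide)).trans hup
    have hwa : ω.reg r_a = σ.reg r_a := (hf''.1 _ (by decide)).trans hua
    have hwi : ω.arr a_index = τ.arr a_index := (hf''.2 _ (by decide)).trans hui
    set p := σ.reg r_p with hpdef
    set a := σ.reg r_a with hadef
    have hylt : a * j % p < p := Nat.mod_lt _ (by omega)
    have hmod := (hw.divMod (a * j % p) (by omega)).2
    have hidx := hτ (a * j % p % m) (Nat.mod_lt _ (by omega))
    have hnext : a * (j + 1) % p = if a * j % p + a < p then a * j % p + a else a * j % p + a - p := by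
      rw [Nat.mul_succ, Nat.add_mod, Nat.mod_eq_of_lt ha]
      split
      · rename_i hlt
        exact Nat.mod_eq_of_lt hlt
      · rw [Nat.mod_eq_sub_mod (by omega), Nat.mod_eq_of_lt (by omega)]
    refine Spec.seq (c := 5) (c' := 1 + 1) (B := fun χ => χ.reg 20 = a * j % p + a ∧
      χ.reg 21 = p - (a * j % p + a) ∧ χ.reg r_p = p ∧
      ∀ v < j + 1, χ.arr a_label v = label I.k p a (σ.reg r_e) v) (Spec.block ?_) ?_
    · simp only [List.foldl_cons, List.foldl_nil, Instr.exec, State.setReg, State.setArr]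
      refine ⟨by simp [h20, hwa], by simp [h20, hwa, hwp], by simp [hwp], fun v hv => ?_⟩
      by_cases hvj : v = j
      · subst hvj
        simp [hωj, h20, hmod, hwi, ← hm, hidx, label]
      · simpa [hωj, hvj] using hlab v (by omega)
    · rintro χ - ⟨hc20, hc21, hcp, hc⟩
      refine Spec.ifNonzero (fun hne => ⟨0, χ, .skip χ, by omega, ?_⟩) fun he => Spec.block ?_
      · exact ⟨by rw [hnext, if_pos (by omega), hc20], hc⟩
      · simp only [List.foldl_cons, List.foldl_nil, Instr.exec, State.setReg]
        exact ⟨by simp [hnext, hc20, hcp]; omega, hc⟩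

theorem spec_startProgram {L : ℕ → ℕ} {σ : State} (h : Ready I σ)
    (hL : ∀ v < I.n, σ.arr a_label v = L v) :
    Spec I.table startProgram σ (4 * ((I.k + 1) * I.nodes) + 11) fun τ =>
      I.BudgetSound L (τ.arr a_budget) ∧ I.BudgetComplete L 0 (τ.arr a_budget) := by
  have hclear := spec_clearProgram (F := I.table) (a := a_budget) (b := r_size) h.one h.zero
  rw [h.size] at hclear
  have hdiv : (I.source * I.T : ℕ) / I.T = I.source := Nat.mul_div_cancel _ I.T_pos
  refine Spec.weaken (c := (4 * ((I.k + 1) * I.nodes) + 3) + (4 + ((1 + 1) + 2)))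
    (B := fun τ => ∃ D : ℕ → ℕ, (∀ z < (I.k + 1) * I.nodes, D z = 0) ∧ τ.arr a_budget =
      Function.update D (I.target L 0 (I.source * I.T)) (I.budget + 1))
    (hclear.seq fun τ hf hτ => ?_) (by omega) ?_
  · have h' : Ready I τ := h.frame hf (by unfold Program.Keeps; decide)
    have hsrc : τ.arr a_label I.source = L I.source := by
      rw [hf.2 _ (by decide), hL _ I.source.2]
    refine Spec.seq (B := fun υ => υ.reg 21 = (L I.source - 1) + (1 - L I.source) )
      (Spec.block ?_) fun υ hf' hυ => ?_
    · simp [Instr.exec, State.setReg, h'.source, h'.one, hsrc]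
    · have hu : Ready I υ := h'.frame hf' (by unfold Program.Keeps; decide)
      have hua : υ.arr a_budget = τ.arr a_budget := hf'.2 _ (by decide)
      refine Spec.seq (B := fun ω => ω.reg 22 = I.target L 0 (I.source * I.T))
        (Spec.ifNonzero (c := 1) (fun hne => Spec.block ?_) fun he => Spec.block ?_)
        fun ω hf'' hω => Spec.block ?_
      · have : L I.source ≠ 1 := by omega
        simp [Instr.exec, State.setReg, hu.start, hu.zero, CCTOInstance.target, hdiv, advance, this]
      · have : L I.source = 1 := by omega
        simp [Instr.exec, State.setReg, hu.start, hu.nodes, CCTOInstance.target, hdiv, advance,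
          this, add_comm]
      · have hw : Ready I ω := hu.frame hf'' (by unfold Program.Keeps; decide)
        have hwa : ω.arr a_budget = τ.arr a_budget := (hf''.2 _ (by decide)).trans hua
        exact ⟨τ.arr a_budget, hτ, by
          simp [Instr.exec, State.setReg, State.setArr, hω, hw.budget, hw.one, hwa]⟩
  · rintro τ - ⟨D, hD, heq⟩
    rw [heq]
    refine ⟨CCTOInstance.budgetSound_start fun i hi x hx => hD _ ?_,
      CCTOInstance.budgetComplete_start D⟩
    have := Nat.mul_le_mul_right I.nodes hi
    rw [Nat.succ_mul]
    omega

theorem spec_relaxProgram {L : ℕ → ℕ} {σ : State} {i x y : ℕ} (h : Ready I σ)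
    (hL : ∀ v < I.n, σ.arr a_label v = L v) (hx : σ.reg 50 = x) (hy : σ.reg 52 = y)
    (hxN : x < I.nodes) (hyN : y < I.nodes) (hlayer : σ.reg r_layer = i * I.nodes)
    (hnext : σ.reg r_next = (i + 1) * I.nodes) (hlabel : σ.reg r_label = i + 1) :
    Spec I.table relaxProgram σ 20 fun τ =>
      τ.arr a_budget = I.relax L i x y (σ.arr a_budget) := by
  obtain ⟨hvx, htx⟩ := h.vertexTime x hxN
  obtain ⟨hvy, hty⟩ := h.vertexTime y hyN
  have hyn : y / I.T < I.n := Nat.div_lt_of_lt_mul (by rw [Nat.mul_comm]; exact hyN)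
  refine Spec.seq (c := 5) (c' := 14 + 1) (B := fun υ => υ.reg 22 = y / I.T ∧ υ.reg 27 = I.word x y)
    (Spec.block ?_) fun υ hf ⟨h22, h27⟩ => ?_
  · simp [Instr.exec, State.setReg, hx, hy, hvx, hvy, htx, hty, CCTOInstance.word]
  have hu : Ready I υ := h.frame hf (by unfold Program.Keeps; decide)
  have hux : υ.reg 50 = x := (hf.1 _ (by decide)).trans hx
  have huy : υ.reg 52 = y := (hf.1 _ (by decide)).trans hy
  have hulayer : υ.reg r_layer = i * I.nodes := (hf.1 _ (by decide)).trans hlayer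
  have hunext : υ.reg r_next = (i + 1) * I.nodes := (hf.1 _ (by decide)).trans hnext
  have hulabel : υ.reg r_label = i + 1 := (hf.1 _ (by decide)).trans hlabel
  have hul : υ.arr a_label (y / I.T) = L (y / I.T) := by
    rw [hf.2 _ (by decide), hL _ hyn]
  have hub : υ.arr a_budget = σ.arr a_budget := hf.2 _ (by decide)
  refine Spec.ifNonzero (fun hne => ?_) fun he => ⟨0, υ, .skip υ, by omega, ?_⟩
  swap
  · rw [CCTOInstance.relax, if_pos (by omega)]
    exact hub
  refine Spec.seq (c := 4) (c' := (1 + 1) + 8)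
    (B := fun ω => ω.reg 29 = (L (y / I.T) - (i + 1)) + ((i + 1) - L (y / I.T)))
    (Spec.block ?_) fun ω hf' h29 => ?_
  · simp [Instr.exec, State.setReg, h22, hul, hulabel]
  have hwx : ω.reg 50 = x := (hf'.1 _ (by decide)).trans hux
  have hwy : ω.reg 52 = y := (hf'.1 _ (by decide)).trans huy
  have hwlayer : ω.reg r_layer = i * I.nodes := (hf'.1 _ (by decide)).trans hulayer
  have hwnext : ω.reg r_next = (i + 1) * I.nodes := (hf'.1 _ (by decide)).trans hunext
  refine Spec.seq (B := fun χ => χ.reg 20 = I.target L i y)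
    (Spec.ifNonzero (c := 1) (fun hne => Spec.block ?_) fun he => Spec.block ?_)
    fun χ hf'' h20 => Spec.block ?_
  · have : L (y / I.T) ≠ i + 1 := by omega
    simp [Instr.exec, State.setReg, hwlayer, hwy, CCTOInstance.target, advance, this]
  · have : L (y / I.T) = i + 1 := by omega
    simp [Instr.exec, State.setReg, hwnext, hwy, CCTOInstance.target, advance, this]
  · have hcx : χ.reg 50 = x := (hf''.1 _ (by decide)).trans hwx
    have hclayer : χ.reg r_layer = i * I.nodes := (hf''.1 _ (by decide)).trans hwlayer
    have hc27 : χ.reg 27 = I.word x y :=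
      (hf''.1 _ (by decide)).trans ((hf'.1 _ (by decide)).trans h27)
    have hcb : χ.arr a_budget = σ.arr a_budget :=
      (hf''.2 _ (by decide)).trans ((hf'.2 _ (by decide)).trans hub)
    have hc1 : χ.reg r_one = 1 :=
      (hf''.1 _ (by decide)).trans ((hf'.1 _ (by decide)).trans hu.one)
    rw [CCTOInstance.relax, if_neg (by omega)]
    simp [Instr.exec, State.setReg, State.setArr, h20, hcx, hclayer, hc27, hcb, hc1]
    congr 1
    omega

/-! ### Rounds and the search over all labellings -/

/-- The increases made by the single moves add up, since each is sound and lowers no entry. -/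
theorem spec_layerProgram {L : ℕ → ℕ} {σ : State} {i : ℕ} (h : Ready I σ)
    (hL : ∀ v < I.n, σ.arr a_label v = L v) (hi : i ≤ I.k) (hN : 0 < I.nodes)
    (hlayer : σ.reg r_layer = i * I.nodes) (hnext : σ.reg r_next = (i + 1) * I.nodes)
    (hlabel : σ.reg r_label = i + 1) :
    Spec I.table layerProgram σ (32 * (I.nodes * I.nodes)) fun τ =>
      I.Improves L (σ.arr a_budget) (τ.arr a_budget)
        fun i' x y => i' = i ∧ x < I.nodes ∧ y < I.nodes := by
  refine Spec.forLoop_mul (K := 26) (X := I.nodes) (fun j τ =>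
    I.Improves L (σ.arr a_budget) (τ.arr a_budget)
      fun i' x y => i' = i ∧ x < j ∧ y < I.nodes) le_rfl hN hN h.nodes h.one h.zero (by decide)
      ?_ ?_ ?_
  · intro j τ τ' hτ hoff
    rwa [hoff.2]
  · exact (CCTOInstance.Improves.refl _).subset fun _ _ _ h => absurd h.2.1 (by omega)
  · intro x hx τ hτx hf hτ
    have hr : Ready I τ := h.frame hf keeps_layerProgram
    have hLτ : ∀ v < I.n, τ.arr a_label v = L v := by rwa [hf.2 a_label (by decide)]
    have e1 : τ.reg r_layer = i * I.nodes := (hf.1 _ (by decide)).trans hlayer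
    have e2 : τ.reg r_next = (i + 1) * I.nodes := (hf.1 _ (by decide)).trans hnext
    have e3 : τ.reg r_label = i + 1 := (hf.1 _ (by decide)).trans hlabel
    refine Spec.weaken (Spec.forLoop_mul (K := 20) (X := 1) (fun j υ =>
      I.Improves L (τ.arr a_budget) (υ.arr a_budget)
        fun i' x' y => i' = i ∧ x' = x ∧ y < j) le_rfl hN one_pos hr.nodes hr.one hr.zero
        (by decide) ?_ ?_ ?_) (by rw [Nat.mul_one]) fun υ _ hυ => hτ.trans hυ (by omega)
    · intro j υ υ' hυ hoff
      rwa [hoff.2]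
    · exact (CCTOInstance.Improves.refl _).subset fun _ _ _ h => absurd h.2.2 (by omega)
    · intro y hy υ hυy hf' hυ
      have hu : Ready I υ := hr.frame hf' (by unfold Program.Keeps; decide)
      refine (spec_relaxProgram (L := L) (x := x) (y := y) (i := i) hu ?_
        ((hf'.1 _ (by decide)).trans hτx) hυy hx hy ((hf'.1 _ (by decide)).trans e1)
        ((hf'.1 _ (by decide)).trans e2) ((hf'.1 _ (by decide)).trans e3)).weaken le_rfl ?_
      · rwa [hf'.2 a_label (by decide)]
      · intro ω _ hω
        rw [hω]
        exact hυ.trans (CCTOInstance.improves_relax hi hx hy _) (by omega)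

theorem spec_roundProgram {L : ℕ → ℕ} {σ : State} (h : Ready I σ)
    (hL : ∀ v < I.n, σ.arr a_label v = L v) (hN : 0 < I.nodes) :
    Spec I.table roundProgram σ (42 * ((I.k + 1) * (I.nodes * I.nodes))) fun τ =>
      I.Improves L (σ.arr a_budget) (τ.arr a_budget)
        fun i x y => i ≤ I.k ∧ x < I.nodes ∧ y < I.nodes := by
  have hNN : 0 < I.nodes * I.nodes := Nat.mul_pos hN hN
  refine Spec.weaken (c := 1 + (35 + 6) * ((I.k + 1) * (I.nodes * I.nodes)))
    (B := fun τ => τ.reg r_layer = (I.k + 1) * I.nodes ∧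
      I.Improves L (σ.arr a_budget) (τ.arr a_budget)
        fun i x y => i < I.k + 1 ∧ x < I.nodes ∧ y < I.nodes)
    (Spec.seq Spec.block_eq fun τ hf hτ => ?_)
    (by have : 0 < (I.k + 1) * (I.nodes * I.nodes) := Nat.mul_pos (by omega) hNN
        omega) fun τ _ hτ => hτ.2.subset (by omega)
  have hr : Ready I τ := h.frame hf (by unfold Program.Keeps; decide)
  have hLτ : ∀ v < I.n, τ.arr a_label v = L v := by rwa [hf.2 a_label (by decide)]
  refine Spec.forLoop_mul (K := 35) (X := I.nodes * I.nodes) (fun j υ =>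
    υ.reg r_layer = j * I.nodes ∧ I.Improves L (σ.arr a_budget) (υ.arr a_budget)
      fun i x y => i < j ∧ x < I.nodes ∧ y < I.nodes) le_rfl (by omega) hNN hr.ksucc hr.one hr.zero
      (by decide) ?_ ?_ ?_
  · intro j υ υ' hυ hoff
    rwa [hoff.2, hoff.1 r_layer (by decide) (by decide)]
  · subst hτ
    refine ⟨by simp [Instr.exec, State.setReg], ?_⟩
    exact (CCTOInstance.Improves.refl _).subset fun _ _ _ h => absurd h.1 (by omega)
  · rintro i hi υ hυi hf' ⟨hlayer, himp⟩
    have hu : Ready I υ := hr.frame hf' (by unfold Program.Keeps; decide)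
    have hLυ : ∀ v < I.n, υ.arr a_label v = L v := by rwa [hf'.2 a_label (by decide)]
    refine Spec.weaken (c := 2 + (32 * (I.nodes * I.nodes) + 1))
      (B := fun ω => ω.reg r_layer = (i + 1) * I.nodes ∧
        I.Improves L (υ.arr a_budget) (ω.arr a_budget)
          fun i' x y => i' = i ∧ x < I.nodes ∧ y < I.nodes)
      (Spec.seq (B := fun ω => ω.reg r_label = i + 1 ∧ ω.reg r_next = (i + 1) * I.nodes)
        (Spec.block ?_) fun ω hf'' ⟨e1, e2⟩ => ?_) (by omega)
      fun ω _ hω => ⟨hω.1, himp.trans hω.2 (by omega)⟩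
    · simp only [List.foldl_cons, List.foldl_nil, Instr.exec, State.setReg]
      refine ⟨by simp [hυi, hu.one], ?_⟩
      simp [hlayer, hu.nodes, Nat.succ_mul]
    · have hw : Ready I ω := hu.frame hf'' (by unfold Program.Keeps; decide)
      have e0 : ω.reg r_layer = i * I.nodes := (hf''.1 _ (by decide)).trans hlayer
      have hub : ω.arr a_budget = υ.arr a_budget := hf''.2 _ (by decide)
      have hspec := spec_layerProgram (L := L) hw (by rwa [hf''.2 a_label (by decide)])
        (Nat.lt_succ_iff.1 hi) hN e0 e2 e1
      refine hspec.seq fun χ hf3 hχ => Spec.block ?_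
      have e3 : χ.reg r_next = (i + 1) * I.nodes := (hf3.1 _ (by decide)).trans e2
      have e4 : χ.reg r_zero = 0 := (hf3.1 _ (by decide)).trans hw.zero
      rw [hub] at hχ
      simp only [List.foldl_cons, List.foldl_nil, Instr.exec, State.setReg]
      exact ⟨by simp [e3, e4], hχ⟩

theorem spec_guessProgram {σ : State} (h : Ready I σ) (hN : 0 < I.nodes) (hn : I.n ≤ I.nodes)
    (he : σ.reg r_e < (I.k * I.k + 1) ^ I.k) (hp : σ.reg r_p ≤ 2 * I.n)
    (ha : σ.reg r_a < σ.reg r_p) :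
    Spec I.table guessProgram σ
      (100 * ((I.k * I.k + 1) * (I.T * ((I.k + 1) * (I.nodes * I.nodes))))) fun τ =>
      (τ.reg r_answer ≠ 0 ↔ σ.reg r_answer ≠ 0 ∨
        I.Accepts (label I.k (σ.reg r_p) (σ.reg r_a) (σ.reg r_e))) := by
  set L := label I.k (σ.reg r_p) (σ.reg r_a) (σ.reg r_e) with hLdef
  set X := (I.k + 1) * (I.nodes * I.nodes) with hX
  have hX1 : (I.k + 1) * I.nodes ≤ X := Nat.mul_le_mul_left _ (Nat.le_mul_of_pos_left _ hN)
  have hXk : I.k + 1 ≤ X := (Nat.le_mul_of_pos_right _ hN).trans hX1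
  have hXn : I.nodes ≤ X := (Nat.le_mul_of_pos_left _ (by omega)).trans hX1
  refine Spec.weaken (c := (4 * (I.k * I.k + 1) + 7 * I.k + 10 * I.n + 11) +
      ((4 * ((I.k + 1) * I.nodes) + 11) + ((42 + 6) * (I.T * X) + 2)))
    (B := fun τ => τ.reg r_answer ≠ 0 ↔ σ.reg r_answer ≠ 0 ∨ I.Accepts L)
    ((spec_labelProgram h he hp ha).seq fun τ hf hτ => ?_) ?_ fun _ _ h => h
  swap
  · have hTX : X ≤ I.T * X := Nat.le_mul_of_pos_left _ I.T_pos
    have h1 : I.T * X ≤ (I.k * I.k + 1) * (I.T * X) := Nat.le_mul_of_pos_left _ (by omega)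
    have h2 : I.k * I.k + 1 ≤ (I.k * I.k + 1) * (I.T * X) := Nat.le_mul_of_pos_right _ (by omega)
    omega
  have hr : Ready I τ := h.frame hf keeps_labelProgram
  refine (spec_startProgram (L := L) hr hτ).seq fun υ hf' hυ => ?_
  have hu : Ready I υ := hr.frame hf' keeps_startProgram
  have hLυ : ∀ v < I.n, υ.arr a_label v = L v := by rwa [hf'.2 a_label (by decide)]
  have hua : υ.reg r_answer = σ.reg r_answer :=
    (hf'.1 _ (by decide)).trans (hf.1 _ (by decide))
  refine Spec.seq (Spec.forLoop_mul (K := 42) (X := X) (fun j ω =>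
    I.BudgetSound L (ω.arr a_budget) ∧ I.BudgetComplete L j (ω.arr a_budget))
    le_rfl I.T_pos (by omega) hu.T hu.one hu.zero (by decide) ?_ hυ ?_) fun ω hf'' hω =>
      Spec.block ?_
  · intro j ω ω' hω hoff
    rwa [hoff.2]
  · rintro j - ω - hf3 ⟨hs, hc⟩
    refine (spec_roundProgram (L := L) (hu.frame hf3 (by unfold Program.Keeps; decide))
      (by rwa [hf3.2 a_label (by decide)]) hN).weaken le_rfl fun χ _ hχ => ⟨hχ.sound hs, hc.succ hχ⟩
  · have hw : Ready I ω := hu.frame hf'' (by unfold Program.Keeps; decide)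
    have hwa : ω.reg r_answer = σ.reg r_answer := (hf''.1 _ (by decide)).trans hua
    have hiff := CCTOInstance.accepts_iff hω.1 hω.2
    rw [hiff]
    simp [Instr.exec, State.setReg, hw.goal, hwa]
    tauto

theorem spec_searchProgram {σ : State} (h : Ready I σ) (hans : σ.reg r_answer = 0)
    (hN : 0 < I.nodes) (hn : I.n ≤ I.nodes) (hn0 : 0 < I.n) :
    Spec I.table searchProgram σ (119 * (2 * I.n * (2 * I.n * ((I.k * I.k + 1) ^ I.k *
      ((I.k * I.k + 1) * (I.T * ((I.k + 1) * (I.nodes * I.nodes)))))))) fun τ =>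
      (τ.reg r_answer ≠ 0 ↔ I.IsYes) := by
  have hsucc : ∀ (P : ℕ → Prop) j, (∃ i < j + 1, P i) ↔ (∃ i < j, P i) ∨ P j := by
    intro P j
    constructor
    · rintro ⟨i, hi, hP⟩
      rcases Nat.lt_succ_iff_lt_or_eq.1 hi with hi | rfl
      exacts [Or.inl ⟨i, hi, hP⟩, Or.inr hP]
    · rintro (⟨i, hi, hP⟩ | hP)
      exacts [⟨i, hi.trans (Nat.lt_succ_self j), hP⟩, ⟨j, Nat.lt_succ_self j, hP⟩]
  set U := (I.k * I.k + 1) * (I.T * ((I.k + 1) * (I.nodes * I.nodes))) with hU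
  have hU0 : 0 < U := Nat.mul_pos (by omega) (Nat.mul_pos I.T_pos (Nat.mul_pos (by omega)
    (Nat.mul_pos hN hN)))
  set c := (I.k * I.k + 1) ^ I.k with hc
  have hc0 : 0 < c := Nat.pow_pos (by omega)
  have hcU : 0 < c * U := Nat.mul_pos hc0 hU0
  have hncU : 0 < 2 * I.n * (c * U) := Nat.mul_pos (by omega) hcU
  rw [I.isYes_iff]
  refine Spec.forLoop_mul (K := 113) (X := 2 * I.n * (c * U)) (fun j τ => (τ.reg r_answer ≠ 0 ↔
    ∃ j' < j, ∃ a < I.n + j', ∃ e < c, I.Accepts (label I.k (I.n + j') a e)))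
    (by omega) (by omega) hncU h.nsucc h.one h.zero (by decide) ?_ ?_ ?_
  · intro j τ τ' hτ hoff
    rwa [hoff.1 r_answer (by decide) (by decide)]
  · simp [hans]
  intro j hj τ hτj hf hτ
  have hr : Ready I τ := h.frame hf keeps_searchProgram
  refine Spec.weaken (c := 1 + (106 + 6) * (2 * I.n * (c * U)))
    (Spec.seq (B := fun υ => υ.reg r_p = I.n + j) (Spec.block ?_) fun υ hf' hp =>
      Spec.forLoop_mul (K := 106) (X := c * U) (fun a ω => (ω.reg r_answer ≠ 0 ↔
        τ.reg r_answer ≠ 0 ∨ ∃ a' < a, ∃ e < c, I.Accepts (label I.k (I.n + j) a' e)))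
        (by omega) (by omega) hcU hp ?_ ?_ (by decide) ?_ ?_ ?_)
    (by omega) (fun ω _ hω => ?_)
  · simp [Instr.exec, State.setReg, hr.n, hτj]
  · exact (hr.frame hf' (by unfold Program.Keeps; decide)).one
  · exact (hr.frame hf' (by unfold Program.Keeps; decide)).zero
  · intro a ω ω' hω hoff
    rwa [hoff.1 r_answer (by decide) (by decide)]
  · simp [hf'.1 r_answer (by decide)]
  · intro a ha ω hωa hf'' hω
    have hw : Ready I ω := (hr.frame hf' (by unfold Program.Keeps; decide)).frame hf''
      (by unfold Program.Keeps; decide)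
    have hωp : ω.reg r_p = I.n + j := (hf''.1 _ (by decide)).trans hp
    refine (Spec.forLoop_mul (K := 100) (X := U) (fun e χ => (χ.reg r_answer ≠ 0 ↔
        ω.reg r_answer ≠ 0 ∨ ∃ e' < e, I.Accepts (label I.k (I.n + j) a e')))
        le_rfl hc0 hU0 hw.codes hw.one hw.zero (by decide) ?_ (by simp) ?_).weaken le_rfl
        fun χ _ hχ => ?_
    · intro e χ χ' hχ hoff
      rwa [hoff.1 r_answer (by decide) (by decide)]
    · intro e he χ hχe hf3 hχ
      have hx : Ready I χ := hw.frame hf3 (by unfold Program.Keeps; decide)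
      have hχp : χ.reg r_p = I.n + j := (hf3.1 _ (by decide)).trans hωp
      have hχa : χ.reg r_a = a := (hf3.1 _ (by decide)).trans hωa
      refine (spec_guessProgram hx hN hn (by omega) (by omega) (by omega)).weaken le_rfl
        fun ψ _ hψ => ?_
      rw [hψ, hχ, hsucc, hχp, hχa, hχe, or_assoc]
    · rw [hχ, hω, hsucc, or_assoc]
  · rw [hω, hτ, hsucc]

/-! ### The whole program -/

theorem spec_codesLoop {σ : State} {m k : ℕ} (h1 : σ.reg r_one = 1) (h0 : σ.reg r_zero = 0)
    (hm : σ.reg r_colours = m) (hk : σ.reg r_k = k) (hc : σ.reg r_codes = 1) {F} :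
    Spec F (forLoop 54 55 r_k (.seq (mulProgram 20 r_codes r_colours)
      (block [.add r_codes 20 r_zero]))) σ (k * (4 * m + 8) + 3) fun τ =>
        τ.reg r_codes = m ^ k := by
  refine Spec.forLoop (K := 4 * m + 5) (fun j τ => τ.reg r_codes = m ^ j) hk h1 h0 (by decide)
    ?_ (by simpa using hc) ?_
  · intro j τ τ' hτ hoff
    rwa [hoff.1 _ (by decide) (by decide)]
  · intro j hj τ _ hf hτ
    have hτ1 : τ.reg r_one = 1 := (hf.1 _ (by decide)).trans h1
    have hτ0 : τ.reg r_zero = 0 := (hf.1 _ (by decide)).trans h0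
    have hτm : τ.reg r_colours = m := (hf.1 _ (by decide)).trans hm
    have hmul := spec_mulProgram (F := F) (d := 20) (x := r_codes) (b := r_colours) hτ1 hτ0
      (by decide) (by decide)
    rw [hτm, hτ] at hmul
    refine (hmul.seq (c' := 1) fun υ hf' hυ => Spec.block ?_).weaken le_rfl fun _ _ h => h
    have hu0 : υ.reg r_zero = 0 := (hf'.1 _ (by decide)).trans hτ0
    simp [Instr.exec, State.setReg, hυ, hu0, pow_succ]

theorem spec_numbersProgram : Spec I.table numbersProgram I.initialState
    (I.k * (4 * (I.k * I.k + 1) + 16) + 4 * I.n + 8 * I.T + 36) fun τ =>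
      Numbers I τ ∧ τ.reg r_answer = 0 := by
  set σ := I.initialState with hσ
  refine Spec.weaken (c := 3 + ((4 * I.k + 4) + (2 + ((I.k * (4 * (I.k * I.k + 1) + 8) + 3) +
    ((4 * I.n + 4) + ((4 * I.T + 4) + ((4 * I.k + 4) + ((4 * I.T + 4) + 8))))))))
    (B := fun τ => Numbers I τ ∧ τ.reg r_answer = 0) ?_ (by
      have : I.k * (4 * (I.k * I.k + 1) + 16) =
        I.k * (4 * (I.k * I.k + 1) + 8) + 8 * I.k := by ring
      omega) fun _ _ h => h
  refine Spec.seq (B := fun τ => τ.reg r_one = 1 ∧ τ.reg r_zero = 0 ∧ τ.reg r_answer = 0)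
    (Spec.block (by simp [Instr.exec, State.setReg])) fun σ₁ f₁ ⟨one₁, zero₁, ans₁⟩ => ?_
  have inp₁ : ∀ r < 6, σ₁.reg r = σ.reg r := fun r hr => f₁.1 r (by revert r; decide)
  have k₁ : σ₁.reg r_k = I.k := inp₁ _ (by decide)
  have m₂ := spec_mulProgram (F := I.table) (d := r_colours) (x := r_k) (b := r_k) one₁ zero₁
    (by decide) (by decide)
  rw [k₁] at m₂
  refine m₂.seq fun σ₂ f₂ colours₂ => ?_
  have inp₂ : ∀ r < 8, σ₂.reg r = σ₁.reg r := fun r hr => f₂.1 r (by revert r; decide)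
  refine Spec.seq (B := fun τ => τ.reg r_colours = I.k * I.k + 1 ∧ τ.reg r_codes = 1)
    (Spec.block (by simp [Instr.exec, State.setReg, colours₂, inp₂, one₁]))
    fun σ₃ f₃ ⟨colours₃, codes₃⟩ => ?_
  have inp₃ : ∀ r < 8, σ₃.reg r = σ₁.reg r :=
    fun r hr => (f₃.1 r (by revert r; decide)).trans (inp₂ r hr)
  refine (spec_codesLoop ((inp₃ _ (by decide)).trans one₁) ((inp₃ _ (by decide)).trans zero₁)
    colours₃ ((inp₃ _ (by decide)).trans k₁) codes₃).seq fun σ₄ f₄ codes₄ => ?_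
  have inp₄ : ∀ r < 8, σ₄.reg r = σ₁.reg r :=
    fun r hr => (f₄.1 r (by revert r; decide)).trans (inp₃ r hr)
  have m₅ := spec_mulProgram (F := I.table) (d := r_nodes) (x := r_T) (b := r_n)
    ((inp₄ _ (by decide)).trans one₁) ((inp₄ _ (by decide)).trans zero₁) (by decide) (by decide)
  rw [inp₄ r_n (by decide), inp₁ r_n (by decide), inp₄ r_T (by decide), inp₁ r_T (by decide)] at m₅
  refine m₅.seq fun σ₅ f₅ nodes₅ => ?_
  have inp₅ : ∀ r < 8, σ₅.reg r = σ₁.reg r :=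
    fun r hr => (f₅.1 r (by revert r; decide)).trans (inp₄ r hr)
  have m₆ := spec_mulProgram (F := I.table) (d := r_start) (x := r_source) (b := r_T)
    ((inp₅ _ (by decide)).trans one₁) ((inp₅ _ (by decide)).trans zero₁) (by decide) (by decide)
  rw [inp₅ r_source (by decide), inp₁ r_source (by decide), inp₅ r_T (by decide),
    inp₁ r_T (by decide)] at m₆
  refine m₆.seq fun σ₆ f₆ start₆ => ?_
  have inp₆ : ∀ r < 8, σ₆.reg r = σ₁.reg r :=
    fun r hr => (f₆.1 r (by revert r; decide)).trans (inp₅ r hr)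
  have nodes₆ : σ₆.reg r_nodes = I.nodes :=
    (f₆.1 _ (by decide)).trans (nodes₅.trans (Nat.mul_comm I.T I.n))
  have m₇ := spec_mulProgram (F := I.table) (d := 20) (x := r_nodes) (b := r_k)
    ((inp₆ _ (by decide)).trans one₁) ((inp₆ _ (by decide)).trans zero₁) (by decide) (by decide)
  rw [inp₆ r_k (by decide), k₁, nodes₆] at m₇
  refine m₇.seq fun σ₇ f₇ prod₇ => ?_
  have inp₇ : ∀ r < 8, σ₇.reg r = σ₁.reg r :=
    fun r hr => (f₇.1 r (by revert r; decide)).trans (inp₆ r hr)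
  have m₈ := spec_mulProgram (F := I.table) (d := 21) (x := r_sink) (b := r_T)
    ((inp₇ _ (by decide)).trans one₁) ((inp₇ _ (by decide)).trans zero₁) (by decide) (by decide)
  rw [inp₇ r_sink (by decide), inp₁ r_sink (by decide), inp₇ r_T (by decide),
    inp₁ r_T (by decide)] at m₈
  refine m₈.seq fun σ₈ f₈ sink₈ => Spec.block ?_
  have inp₈ : ∀ r < 8, σ₈.reg r = σ₁.reg r :=
    fun r hr => (f₈.1 r (by revert r; decide)).trans (inp₇ r hr)
  have n₈ : σ₈.reg r_n = I.n := (inp₈ _ (by decide)).trans (inp₁ _ (by decide))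
  have T₈ : σ₈.reg r_T = I.T := (inp₈ _ (by decide)).trans (inp₁ _ (by decide))
  have k₈ : σ₈.reg r_k = I.k := (inp₈ _ (by decide)).trans k₁
  have budget₈ : σ₈.reg r_budget = I.budget := (inp₈ _ (by decide)).trans (inp₁ _ (by decide))
  have source₈ : σ₈.reg r_source = I.source := (inp₈ _ (by decide)).trans (inp₁ _ (by decide))
  have one₈ : σ₈.reg r_one = 1 := (inp₈ _ (by decide)).trans one₁
  have zero₈ : σ₈.reg r_zero = 0 := (inp₈ _ (by decide)).trans zero₁
  have ans₈ : σ₈.reg r_answer = 0 := by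
    rw [f₈.1 _ (by decide), f₇.1 _ (by decide), f₆.1 _ (by decide), f₅.1 _ (by decide),
      f₄.1 _ (by decide), f₃.1 _ (by decide), f₂.1 _ (by decide), ans₁]
  have colours₈ : σ₈.reg r_colours = I.k * I.k + 1 := by
    rw [f₈.1 _ (by decide), f₇.1 _ (by decide), f₆.1 _ (by decide), f₅.1 _ (by decide),
      f₄.1 _ (by decide), colours₃]
  have codes₈ : σ₈.reg r_codes = (I.k * I.k + 1) ^ I.k := by
    rw [f₈.1 _ (by decide), f₇.1 _ (by decide), f₆.1 _ (by decide), f₅.1 _ (by decide), codes₄]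
  have nodes₈ : σ₈.reg r_nodes = I.nodes := by
    rw [f₈.1 _ (by decide), f₇.1 _ (by decide), nodes₆]
  have start₈ : σ₈.reg r_start = I.source * I.T := by
    rw [f₈.1 _ (by decide), f₇.1 _ (by decide), start₆]
    rfl
  have prod₈ : σ₈.reg 20 = I.nodes * I.k := by rw [f₈.1 _ (by decide), prod₇]
  have sink₈' : σ₈.reg 21 = I.sink * I.T := sink₈
  refine ⟨?_, by simp [Instr.exec, State.setReg, ans₈]⟩
  constructor <;> simp only [List.foldl_cons, List.foldl_nil, Instr.exec, State.setReg]
  case goal => simp [prod₈, sink₈', T₈, one₈, Nat.mul_comm]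
  case len => simp [n₈, one₈, codes₈]; omega
  case size => simp [prod₈, nodes₈]; ring
  all_goals simp [n₈, T₈, k₈, budget₈, source₈, one₈, zero₈, colours₈, codes₈, nodes₈, start₈]

/-- The program solves CCTO; the number of steps is of the order of the number of labellings, at
most `2n · 2n · (k² + 1) ^ k`, times `T` rounds over all progresses and pairs of nodes. -/
theorem exists_solvedInSteps (I : CCTOInstance) : ∃ t, I.SolvedInSteps cctoProgram t ∧
    t ≤ 700 * ((I.k * I.k + 1) ^ (I.k + 2) * (I.n ^ 4 * I.T ^ 4)) := by
  have hn0 : 0 < I.n := Nat.zero_lt_of_lt I.source.2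
  have hT0 := I.T_pos
  have hN : 0 < I.nodes := Nat.mul_pos hn0 hT0
  have hn : I.n ≤ I.nodes := Nat.le_mul_of_pos_right _ hT0
  set m := I.k * I.k + 1 with hm
  set S := 2 * I.n * (2 * I.n * (m ^ I.k * (m * (I.T * ((I.k + 1) * (I.nodes * I.nodes)))))) with hS
  have hspec : Spec I.table cctoProgram I.initialState
      ((I.k * (4 * m + 16) + 4 * I.n + 8 * I.T + 36) +
        ((10 * (m ^ I.k + (2 * I.n + 1)) + 5) + ((10 * I.nodes + 5) + (119 * S + (1 + 1)))))
      fun τ => (τ.reg 0 ≠ 0 ↔ I.IsYes) ∧ τ.reg 0 ≤ 1 := by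
    refine spec_numbersProgram.seq fun τ _ ⟨hτ, hans⟩ => ?_
    have h1 := spec_divModProgram (F := I.table) (q := a_div) (r := a_mod) (m := r_colours)
      (len := r_len) hτ.one hτ.zero (by decide) (by decide) (by rw [hτ.colours]; omega) (by decide)
    rw [hτ.len, hτ.colours] at h1
    refine h1.seq fun υ hf hυ => ?_
    have hu : Numbers I υ := hτ.frame hf (by decide)
    have hua : υ.reg r_answer = 0 := (hf.1 _ (by decide)).trans hans
    have h2 := spec_divModProgram (F := I.table) (q := a_vertex) (r := a_time) (m := r_T)
      (len := r_nodes) hu.one hu.zero (by decide) (by decide) (by rw [hu.T]; exact hT0) (by decide)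
    rw [hu.nodes, hu.T] at h2
    refine h2.seq fun ω hf' hω => ?_
    have hw : Ready I ω := ⟨hu.frame hf' (by decide), by
      rw [hf'.2 _ (by decide), hf'.2 _ (by decide)]; exact hυ, hω⟩
    refine (spec_searchProgram hw ((hf'.1 _ (by decide)).trans hua) hN hn hn0).seq
      fun χ _ hχ => Spec.ifNonzero (fun hne => Spec.block ?_) fun he => Spec.block ?_
    · simp [Instr.exec, State.setReg, hχ.1 hne]
    · have : ¬ I.IsYes := fun h => (hχ.2 h) he
      simp [Instr.exec, State.setReg, this]
  obtain ⟨t, τ, hrun, ht, hiff, hle⟩ := hspec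
  refine ⟨t, ⟨τ, hrun, ?_⟩, ht.trans ?_⟩
  · split
    · rename_i h
      have := hiff.2 h
      omega
    · rename_i h
      by_contra h0
      exact h (hiff.1 h0)
  · -- Every term of the cost is at most a constant multiple of `Z`.
    set Z := m ^ I.k * m * (I.k + 1) * (I.n ^ 4 * I.T ^ 4) with hZ
    have hmk : 0 < m ^ I.k := Nat.pow_pos (by omega)
    have hZ0 : 0 < Z := by positivity
    have e1 : I.k * m ≤ Z := (Nat.mul_le_mul_right m (Nat.le_succ I.k)).trans
      (Nat.le_of_dvd hZ0 ⟨m ^ I.k * (I.n ^ 4 * I.T ^ 4), by rw [hZ, Nat.succ_eq_add_one]; ring⟩)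
    have e2 : I.n ≤ Z := Nat.le_of_dvd hZ0
      ⟨m ^ I.k * m * (I.k + 1) * (I.n ^ 3 * I.T ^ 4), by rw [hZ]; ring⟩
    have e3 : I.T ≤ Z := Nat.le_of_dvd hZ0
      ⟨m ^ I.k * m * (I.k + 1) * (I.n ^ 4 * I.T ^ 3), by rw [hZ]; ring⟩
    have e4 : m ^ I.k ≤ Z := Nat.le_of_dvd hZ0
      ⟨m * (I.k + 1) * (I.n ^ 4 * I.T ^ 4), by rw [hZ]; ring⟩
    have e5 : I.nodes ≤ Z := Nat.le_of_dvd hZ0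
      ⟨m ^ I.k * m * (I.k + 1) * (I.n ^ 3 * I.T ^ 3), by rw [hZ, CCTOInstance.nodes]; ring⟩
    have e6 : S ≤ 4 * Z := Nat.le_of_dvd (by omega) ⟨I.T, by
      rw [hZ, hS, CCTOInstance.nodes]; ring⟩
    have e7 : I.k ≤ I.k * m := Nat.le_mul_of_pos_right _ (by omega)
    have e8 : Z ≤ m ^ (I.k + 2) * (I.n ^ 4 * I.T ^ 4) := by
      refine Nat.mul_le_mul_right _ ?_
      rw [pow_add, pow_two, ← Nat.mul_assoc]
      refine Nat.mul_le_mul_left _ ?_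
      have : I.k ≤ I.k * I.k := Nat.le_mul_self _
      omega
    have e9 : I.k * (4 * m + 16) = 4 * (I.k * m) + 16 * I.k := by ring
    omega

end RAM

/-! ### The running time -/

theorem sq_add_one_pow_le (k : ℕ) : (k * k + 1) ^ (k + 2) ≤ 8 * k ^ (8 * k) := by
  rcases Nat.lt_or_ge k 2 with hk | hk
  · interval_cases k <;> norm_num
  · have h1 : k * k + 1 ≤ k ^ 3 := by nlinarith
    calc (k * k + 1) ^ (k + 2) ≤ (k ^ 3) ^ (k + 2) := Nat.pow_le_pow_left h1 _
      _ = k ^ (3 * (k + 2)) := (pow_mul k 3 (k + 2)).symm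
      _ ≤ k ^ (8 * k) := Nat.pow_le_pow_right (by omega) (by omega)
      _ ≤ 8 * k ^ (8 * k) := by omega

theorem exists_solvedInSteps_le (I : CCTOInstance) : ∃ t, I.SolvedInSteps RAM.cctoProgram t ∧
    t ≤ 5600 * I.k ^ (8 * I.k) * (I.T ^ 4 * I.n ^ 4) := by
  obtain ⟨t, ht, hle⟩ := RAM.exists_solvedInSteps I
  refine ⟨t, ht, hle.trans ?_⟩
  calc _ ≤ 700 * (8 * I.k ^ (8 * I.k) * (I.n ^ 4 * I.T ^ 4)) :=
        Nat.mul_le_mul_left _ (Nat.mul_le_mul_right _ (sq_add_one_pow_le _))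
    _ = _ := by ring

theorem computable_mul_pow (C : ℕ) : Computable fun k : ℕ => C * k ^ (C * k) := by
  have hpow : Primrec₂ ((· ^ ·) : ℕ → ℕ → ℕ) := Primrec₂.unpaired'.1 Nat.Primrec.pow
  have hmul : Primrec fun k : ℕ => C * k := Primrec.nat_mul.comp (.const C) .id
  exact (Primrec.nat_mul.comp (.const C) (hpow.comp .id hmul)).to_comp

theorem mainTheorem1 :
    (∃ (P : RAM.Program) (C : ℕ), ∀ I : CCTOInstance, ∃ t : ℕ, I.SolvedInSteps P t ∧
      (t : ℝ) ≤ (C : ℝ) * (I.k : ℝ) ^ (C * I.k) * (I.T : ℝ) ^ 4 * (I.n : ℝ) ^ 4 *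
        Real.log ((I.n : ℝ) + 1)) ∧
    CCTOFixedParameterTractable := by
  have hpow : ∀ k : ℕ, k ^ (8 * k) ≤ k ^ (11200 * k) := by
    intro k
    rcases Nat.eq_zero_or_pos k with rfl | hk
    · simp
    · exact Nat.pow_le_pow_right hk (by omega)
  have key : ∀ I : CCTOInstance, ∃ t, I.SolvedInSteps RAM.cctoProgram t ∧
      2 * t ≤ 11200 * I.k ^ (11200 * I.k) * (I.T ^ 4 * I.n ^ 4) := by
    intro I
    obtain ⟨t, ht, hle⟩ := exists_solvedInSteps_le I
    refine ⟨t, ht, ?_⟩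
    calc 2 * t ≤ 2 * (5600 * I.k ^ (8 * I.k) * (I.T ^ 4 * I.n ^ 4)) := Nat.mul_le_mul_left _ hle
      _ = 11200 * I.k ^ (8 * I.k) * (I.T ^ 4 * I.n ^ 4) := by ring
      _ ≤ _ := Nat.mul_le_mul_right _ (Nat.mul_le_mul_left _ (hpow _))
  refine ⟨⟨RAM.cctoProgram, 11200, fun I => ?_⟩,
    RAM.cctoProgram, fun k => 11200 * k ^ (11200 * k), 2, computable_mul_pow 11200, fun I => ?_⟩
  · obtain ⟨t, ht, hle⟩ := key I
    refine ⟨t, ht, ?_⟩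
    have hn : 1 ≤ I.n := Nat.one_le_of_lt I.source.2
    -- As `n ≥ 1`, the logarithm is at least `log 2 > 1 / 2`.
    have hlog : (1 / 2 : ℝ) ≤ Real.log ((I.n : ℝ) + 1) := by
      have h2 : (2 : ℝ) ≤ (I.n : ℝ) + 1 := by
        have : (1 : ℝ) ≤ I.n := by exact_mod_cast hn
        linarith
      have := Real.log_le_log two_pos h2
      have := Real.log_two_gt_d9
      linarith
    have hle' : 2 * (t : ℝ) ≤
        11200 * (I.k : ℝ) ^ (11200 * I.k) * ((I.T : ℝ) ^ 4 * (I.n : ℝ) ^ 4) := by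
      exact_mod_cast hle
    set A := 11200 * (I.k : ℝ) ^ (11200 * I.k) * ((I.T : ℝ) ^ 4 * (I.n : ℝ) ^ 4) with hA
    have hA0 : 0 ≤ A := by positivity
    calc (t : ℝ) ≤ A * (1 / 2) := by linarith
      _ ≤ A * Real.log ((I.n : ℝ) + 1) := mul_le_mul_of_nonneg_left hlog hA0
      _ = _ := by rw [hA]; push_cast; ring
  · obtain ⟨t, ht, hle⟩ := key I
    refine ⟨t, ht, ?_⟩
    have hsize : I.T ^ 4 * I.n ^ 4 ≤ I.size ^ 2 := by
      calc I.T ^ 4 * I.n ^ 4 = (I.n ^ 2 * I.T ^ 2) ^ 2 := by ring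
        _ ≤ I.size ^ 2 := Nat.pow_le_pow_left (Nat.le_add_right _ _) 2
    exact le_trans (by omega) (Nat.mul_le_mul_left (11200 * I.k ^ (11200 * I.k)) hsize)
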